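/- Let $k\in\mathbb N_0$, let $2>\gamma_0>\gamma_1>\dots>\gamma_k\ge 0$ be real numbers with $\gamma_0>0$, and let $a_0,\dots,a_k\in\mathbb C$ (for instance real) with $a_0\neq 0$. Assume $$(A_0)\qquad \sum_{i=0}^k a_i s^{\gamma_i}\neq 0\quad\text{for all } s\in\mathbb C \text{ with } \operatorname{Re} s>0,$$ with the principal branch of the powers. For a tempered distribution $y\in\mathcal S'(\mathbb R)$ supported in $[0,\infty)$, let its Laplace transform be $\hat y(s)=\langle y(t),\varphi(t)e^{-st}\rangle$, $\operatorname{Re}s>0$, where $\varphi\in C^\infty(\mathbb R)$ equals $1$ on a neighbourhood of $[0,\infty)$ and vanishes near $-\infty$. Then there is exactly one tempered distribution $l$ supported in $[0,\infty)$ with $$\hat l(s)=\frac{1}{\sum_{i=0}^k a_i s^{\gamma_i}},\qquad \operatorname{Re}s>0,$$ and $l$ is given by a function (still denoted by $l$) with $l(t)=0$ for $t<0$ such that (i) $l$ is locally integrable on $\mathbb R$; (ii) if $\gamma_0-\gamma_k>1$, then $l$ is (after a modification on a null set) absolutely continuous on every compact interval of $\mathbb R$. -/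

import Mathlib

open MeasureTheory Set Filter Topology
open scoped SchwartzMap ContDiff

/-- A smooth function on `ℝ` equal to `1` on `[-1, ∞)` and to `0` on `(-∞, -2]`. -/
noncomputable def smoothCutoff (t : ℝ) : ℝ := Real.smoothTransition (t + 2)

/-- The function `t ↦ φ(t) e^{-st}`, with `φ` the cutoff above. -/
noncomputable def cutoffExp (s : ℂ) (t : ℝ) : ℂ := (smoothCutoff t : ℂ) * Complex.exp (-s * t)

theorem cutoffExp_contDiff (s : ℂ) : ContDiff ℝ ∞ (cutoffExp s) := by
  have h1 : ContDiff ℝ ∞ smoothCutoff :=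
    Real.smoothTransition.contDiff.comp (contDiff_id.add contDiff_const)
  have h2 : ContDiff ℝ ∞ (fun t : ℝ => (t : ℂ)) := Complex.ofRealCLM.contDiff
  exact (h2.comp h1).mul ((contDiff_const.mul h2).cexp)

theorem iteratedDeriv_exp_neg_mul (s : ℂ) (n : ℕ) :
    iteratedDeriv n (fun t : ℝ => Complex.exp (-s * t)) =
      fun t : ℝ => (-s) ^ n * Complex.exp (-s * t) := by
  induction n with
  | zero => simp
  | succ n ih =>
    rw [iteratedDeriv_succ, ih]
    funext t
    have h : HasDerivAt (fun t : ℝ => Complex.exp (-s * t)) (Complex.exp (-s * t) * (-s * 1)) t :=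
      ((Complex.ofRealCLM.hasDerivAt (x := t)).const_mul (-s)).cexp
    rw [(h.const_mul ((-s) ^ n)).deriv]
    ring

theorem cutoffExp_decay (s : ℂ) (hs : 0 < s.re) (k n : ℕ) :
    ∃ C : ℝ, ∀ t : ℝ, ‖t‖ ^ k * ‖iteratedFDeriv ℝ n (cutoffExp s) t‖ ≤ C := by
  simp only [norm_iteratedFDeriv_eq_norm_iteratedDeriv]
  have hcont : Continuous fun t : ℝ => ‖t‖ ^ k * ‖iteratedDeriv n (cutoffExp s) t‖ :=
    (continuous_norm.pow k).mul
      ((cutoffExp_contDiff s).continuous_iteratedDeriv n (by exact_mod_cast le_top)).norm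
  have hev : ∀ᶠ t in cocompact ℝ, ‖t‖ ^ k * ‖iteratedDeriv n (cutoffExp s) t‖ ≤ 1 := by
    rw [cocompact_eq_atBot_atTop, eventually_sup]
    constructor
    · filter_upwards [eventually_lt_atBot (-2 : ℝ)] with t ht
      have h : cutoffExp s =ᶠ[𝓝 t] fun _ => 0 := by
        filter_upwards [eventually_lt_nhds ht] with u hu
        simp [cutoffExp, smoothCutoff,
          Real.smoothTransition.zero_of_nonpos (show u + 2 ≤ 0 by linarith)]
      rw [h.iteratedDeriv_eq n]
      simp
    · have hlim : Tendsto (fun t : ℝ => ‖s‖ ^ n * (t ^ k * Real.exp (-s.re * t)))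
          atTop (𝓝 (‖s‖ ^ n * 0)) := by
        refine Tendsto.const_mul _ ?_
        have := (isLittleO_pow_exp_pos_mul_atTop k hs).tendsto_div_nhds_zero
        refine this.congr fun t => ?_
        rw [neg_mul, Real.exp_neg]
        rfl
      rw [mul_zero] at hlim
      filter_upwards [eventually_gt_atTop (0 : ℝ), hlim.eventually_le_const zero_lt_one]
        with t ht hle
      have h : cutoffExp s =ᶠ[𝓝 t] fun t : ℝ => Complex.exp (-s * t) := by
        filter_upwards [eventually_gt_nhds ht] with u hu
        simp [cutoffExp, smoothCutoff,
          Real.smoothTransition.one_of_one_le (show 1 ≤ u + 2 by linarith)]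
      rw [h.iteratedDeriv_eq n, iteratedDeriv_exp_neg_mul]
      simp only [norm_mul, norm_pow, norm_neg, Complex.norm_exp, Real.norm_of_nonneg ht.le]
      have hre : (-s * (t : ℂ)).re = -s.re * t := by simp
      rw [hre]
      linarith
  obtain ⟨K, hK, hsub⟩ := mem_cocompact.1 hev
  obtain ⟨C, hC⟩ := hK.exists_bound_of_continuousOn hcont.continuousOn
  refine ⟨max C 1, fun t => ?_⟩
  by_cases ht : t ∈ K
  · exact ((le_abs_self _).trans (hC t ht)).trans (le_max_left _ _)
  · exact (show _ ≤ (1 : ℝ) from hsub ht).trans (le_max_right _ _)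

/-- For `Re s > 0`, the function `t ↦ φ(t) e^{-st}` as a Schwartz function. -/
noncomputable def laplaceKernel (s : ℂ) (hs : 0 < s.re) : 𝓢(ℝ, ℂ) where
  toFun := cutoffExp s
  smooth' := cutoffExp_contDiff s
  decay' := cutoffExp_decay s hs

/-- The Laplace transform `⟨y(t), φ(t) e^{-st}⟩` at `s`, `Re s > 0`, of a tempered distribution
`y` (meant for `y` supported in `[0, ∞)`). -/
noncomputable def laplaceTransform (y : 𝓢'(ℝ, ℂ)) (s : ℂ) (hs : 0 < s.re) : ℂ :=
  y (laplaceKernel s hs)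

/-- Membership in `𝓢'₊`: the tempered distribution `y` is supported in `[0, ∞)`. -/
def SupportedInNonneg (y : 𝓢'(ℝ, ℂ)) : Prop :=
  Distribution.IsVanishingOn y (Iio (0 : ℝ))

/-- `y` is an inverse Laplace transform of `F` in `𝓢'₊`. -/
def IsInverseLaplace (y : 𝓢'(ℝ, ℂ)) (F : ℂ → ℂ) : Prop :=
  SupportedInNonneg y ∧ ∀ (s : ℂ) (hs : 0 < s.re), laplaceTransform y s hs = F s

/-- The symbol `∑ i, a i * s ^ γ i` (principal branch of the powers). -/
noncomputable def fracSymbol {k : ℕ} (a : Fin (k + 1) → ℂ) (γ : Fin (k + 1) → ℝ) (s : ℂ) : ℂ :=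
  ∑ i, a i * s ^ (γ i : ℂ)

/-- The tempered distribution `y` is given by the function `f`. -/
def IsRepresentedBy (y : 𝓢'(ℝ, ℂ)) (f : ℝ → ℂ) : Prop :=
  ∀ φ : 𝓢(ℝ, ℂ), HasCompactSupport φ → y φ = ∫ t, f t * φ t

/-- `f` is absolutely continuous on every compact interval. -/
def IsLocallyAbsCont (f : ℝ → ℂ) : Prop :=
  ∀ b c : ℝ, AbsolutelyContinuousOnInterval f b c

/-!
The symbol `p(s) = ∑ a_i s ^ γ_i` is holomorphic off the negative real axis, behaves like
`a₀ s ^ γ₀` at infinity and like its lowest nonzero term at the origin, and has zeros of finite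
order on the rest of the imaginary axis. Since `|s - z| ≥ Re s` when `Re z = 0`, compactness turns
this into a bound `|1 / p(s)| ≤ C (min 1 (Re s))⁻ᵐ` on the right half-plane
(`exists_le_norm_fracSymbol`).

Existence holds for every holomorphic `F` with such a bound (`exists_isInverseLaplace`). The
Bromwich integral `h` of `F(s) / (1 + s)²` converges absolutely, does not depend on the abscissa,
vanishes for `t < 0` (abscissa to infinity) and grows polynomially (abscissa `1 / (1 + t)`); Fourier
inversion identifies its Laplace transform, and `h + 2h' + h''` has Laplace transform `F`.

Uniqueness and the representation by a function both rest on one approximation. In the variable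
`x = e^{-t}` exponential sums are polynomials, so by Weierstrass the `N`-th derivative of a test
function is approximated by sums of `e^{-(M+j)t}` with an error `ε e^{-Mt}`, and integrating `N`
times from infinity keeps this bound (`exists_expSum_near_iteratedDeriv`). Hence a tempered
distribution supported in `[0, ∞)` is determined by its Laplace transform at the integers `≥ M`,
even in comparison with functions of exponential growth (`SupportedInNonneg.exists_approx`).

The function is the Neumann series: with `b_i = a_i / a₀` and `δ_i = γ₀ - γ_i`, expanding
`1 / p(s) = a₀⁻¹ s ^ (-γ₀) / (1 + ∑ b_i s ^ (-δ_i))` over words in the indices gives a sum of powers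
of `s`, and `s ^ (-α)` is the Laplace transform of `t ^ (α - 1) / Γ(α)`. For large real `s` the sum
converges absolutely in the `L¹` space weighted by `e^{-st}`, which gives local integrability. If
`γ₀ > 1` then all exponents exceed `1`, and the series is the indefinite integral of the series
with `γ₀ - 1` in place of `γ₀`.
-/

/-! ### Derivatives of products with the cutoff -/

theorem norm_iteratedDeriv_mul_le_of_le {f g : ℝ → ℂ} (hf : ContDiff ℝ ∞ f) (hg : ContDiff ℝ ∞ g)
    {N : ℕ} {t A B : ℝ} (hA : ∀ n ≤ N, ‖iteratedDeriv n f t‖ ≤ A)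
    (hB : ∀ n ≤ N, ‖iteratedDeriv n g t‖ ≤ B) (n : ℕ) (hn : n ≤ N) :
    ‖iteratedDeriv n (fun t => f t * g t) t‖ ≤ 2 ^ n * (A * B) := by
  have hA0 : 0 ≤ A := (norm_nonneg _).trans (hA 0 (Nat.zero_le _))
  rw [iteratedDeriv_fun_mul (hf.of_le (by exact_mod_cast le_top)).contDiffAt
    (hg.of_le (by exact_mod_cast le_top)).contDiffAt]
  refine (norm_sum_le _ _).trans ?_
  have h : ∀ i ∈ Finset.range (n + 1), ‖(n.choose i : ℂ) * iteratedDeriv i f t *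
      iteratedDeriv (n - i) g t‖ ≤ (n.choose i : ℝ) * (A * B) := by
    intro i hi
    have hi' : i ≤ n := Nat.lt_succ_iff.1 (Finset.mem_range.1 hi)
    rw [norm_mul, norm_mul, Complex.norm_natCast, mul_assoc]
    gcongr
    · exact hA i (hi'.trans hn)
    · exact hB (n - i) ((Nat.sub_le _ _).trans hn)
  refine (Finset.sum_le_sum h).trans (le_of_eq ?_)
  rw [← Finset.sum_mul]
  congr 1
  exact_mod_cast Nat.sum_range_choose n

theorem contDiff_smoothCutoff : ContDiff ℝ ∞ (fun t => (smoothCutoff t : ℂ)) := by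
  have h1 : ContDiff ℝ ∞ smoothCutoff :=
    Real.smoothTransition.contDiff.comp (contDiff_id.add contDiff_const)
  exact Complex.ofRealCLM.contDiff.comp h1

theorem smoothCutoff_eq_one {t : ℝ} (ht : -1 ≤ t) : smoothCutoff t = 1 :=
  Real.smoothTransition.one_of_one_le (by linarith)

theorem smoothCutoff_eq_zero {t : ℝ} (ht : t ≤ -2) : smoothCutoff t = 0 :=
  Real.smoothTransition.zero_of_nonpos (by linarith)

theorem exists_bound_iteratedDeriv_smoothCutoff (N : ℕ) :
    ∃ A : ℝ, 0 ≤ A ∧ ∀ n ≤ N, ∀ t, ‖iteratedDeriv n (fun t => (smoothCutoff t : ℂ)) t‖ ≤ A := by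
  have key : ∀ n : ℕ, ∃ A : ℝ, ∀ t,
      ‖iteratedDeriv n (fun t => (smoothCutoff t : ℂ)) t‖ ≤ A := by
    intro n
    have hcont : Continuous (iteratedDeriv n (fun t => (smoothCutoff t : ℂ))) :=
      contDiff_smoothCutoff.continuous_iteratedDeriv n (by exact_mod_cast le_top)
    obtain ⟨C, hC⟩ := (isCompact_Icc (a := (-2 : ℝ)) (b := -1)).exists_bound_of_continuousOn
      hcont.continuousOn
    refine ⟨max C 1, fun t => ?_⟩
    rcases lt_or_ge t (-2) with h | h
    · have : (fun t => (smoothCutoff t : ℂ)) =ᶠ[𝓝 t] fun _ => 0 := by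
        filter_upwards [eventually_lt_nhds h] with u hu
        simp [smoothCutoff_eq_zero hu.le]
      rw [this.iteratedDeriv_eq n]
      simp
    · rcases lt_or_ge (-1) t with h' | h'
      · have : (fun t => (smoothCutoff t : ℂ)) =ᶠ[𝓝 t] fun _ => 1 := by
          filter_upwards [eventually_gt_nhds h'] with u hu
          simp [smoothCutoff_eq_one hu.le]
        rw [this.iteratedDeriv_eq n, iteratedDeriv_const]
        split_ifs <;> simp
      · exact (hC t ⟨h, h'⟩).trans (le_max_left _ _)
  choose A hA using key
  refine ⟨∑ n ∈ Finset.range (N + 1), A n, ?_, fun n hn t => (hA n t).trans ?_⟩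
  · exact Finset.sum_nonneg fun n _ => (norm_nonneg _).trans (hA n 0)
  · exact Finset.single_le_sum (f := A) (fun n _ => (norm_nonneg _).trans (hA n 0))
      (Finset.mem_range.2 (Nat.lt_succ_of_le hn))

/-! ### Approximation by exponential sums -/

/-- The exponential sum `∑_{j < d} c_j e^{-(M+j)t}`. -/
noncomputable def expSum (M d : ℕ) (c : ℕ → ℂ) (t : ℝ) : ℂ :=
  ∑ j ∈ Finset.range d, c j * Complex.exp (-((M + j : ℕ) : ℂ) * t)

theorem contDiff_expSum (M d : ℕ) (c : ℕ → ℂ) : ContDiff ℝ ∞ (expSum M d c) := by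
  unfold expSum
  have h2 : ContDiff ℝ ∞ (fun t : ℝ => (t : ℂ)) := Complex.ofRealCLM.contDiff
  exact ContDiff.sum fun j _ => contDiff_const.mul (contDiff_const.mul h2).cexp

theorem hasDerivAt_expSum {M : ℕ} (hM : 1 ≤ M) (d : ℕ) (c : ℕ → ℂ) (t : ℝ) :
    HasDerivAt (expSum M d fun j => -c j / (M + j : ℕ)) (expSum M d c t) t := by
  unfold expSum
  refine HasDerivAt.fun_sum fun j _ => ?_
  have hne : ((M + j : ℕ) : ℂ) ≠ 0 := Nat.cast_ne_zero.2 (by omega)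
  have h := (((Complex.ofRealCLM.hasDerivAt (x := t)).const_mul (-((M + j : ℕ) : ℂ))).cexp).const_mul
    (-c j / (M + j : ℕ))
  refine h.congr_deriv ?_
  simp only [Complex.ofRealCLM_apply]
  field_simp
  simp

theorem norm_exp_nat_mul (n : ℕ) (t : ℝ) :
    ‖Complex.exp (-(n : ℂ) * t)‖ = Real.exp (-n * t) := by
  rw [Complex.norm_exp]; simp

theorem tendsto_expSum {M : ℕ} (hM : 1 ≤ M) (d : ℕ) (c : ℕ → ℂ) :
    Tendsto (expSum M d c) atTop (𝓝 0) := by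
  unfold expSum
  rw [show (0 : ℂ) = ∑ j ∈ Finset.range d, c j * 0 by simp]
  refine tendsto_finsetSum _ fun j _ => Tendsto.const_mul _ ?_
  rw [tendsto_zero_iff_norm_tendsto_zero]
  simp only [norm_exp_nat_mul]
  refine Real.tendsto_exp_atBot.comp ?_
  refine tendsto_id.const_mul_atTop_of_neg ?_
  have : (1 : ℝ) ≤ ((M + j : ℕ) : ℝ) := by exact_mod_cast (by omega)
  linarith

/-- The Weierstrass theorem in the variable `x = e^{-t}`, applied to `x ↦ ψ(-log x) x^{-M}`, which
vanishes near `0` as `ψ` has compact support. -/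
theorem exists_expSum_near {ψ : ℝ → ℂ} (hψ : Continuous ψ) (hc : HasCompactSupport ψ) {M : ℕ}
    (hM : 1 ≤ M) {ε : ℝ} (hε : 0 < ε) :
    ∃ d c, ∀ t : ℝ, -2 ≤ t → ‖ψ t - expSum M d c t‖ ≤ ε * Real.exp (-M * t) := by
  -- `w 0 = 0` by the convention `0⁻¹ = 0`, as `M ≥ 1`
  set w : ℝ → ℂ := fun x => ψ (-Real.log x) * ((x : ℂ) ^ M)⁻¹ with hw
  have hwc : ContinuousOn w (Icc 0 (Real.exp 2)) := by
    intro x hx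
    refine ContinuousAt.continuousWithinAt ?_
    rcases hx.1.eq_or_lt with rfl | hx0
    · obtain ⟨r, hr⟩ := hc.isBounded.subset_closedBall (0 : ℝ)
      have : w =ᶠ[𝓝 0] fun _ => 0 := by
        filter_upwards [Metric.ball_mem_nhds (0 : ℝ) (Real.exp_pos (-(|r| + 1)))] with y hy
        by_cases hy0 : y = 0
        · simp [hw, hy0, show M ≠ 0 by omega]
        · have h1 : Real.log |y| < -(|r| + 1) := by
            rw [Real.log_lt_iff_lt_exp (abs_pos.2 hy0)]
            simpa using hy
          rw [Real.log_abs] at h1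
          have h2 : ψ (-Real.log y) = 0 := by
            refine image_eq_zero_of_notMem_tsupport fun hmem => ?_
            have := hr hmem
            rw [Metric.mem_closedBall, dist_zero_right, Real.norm_eq_abs] at this
            have h3 := le_abs_self (-Real.log y)
            have h4 := le_abs_self r
            linarith
          simp [hw, h2]
      exact (continuousAt_const (y := (0 : ℂ))).congr this.symm
    · have h1 : ContinuousAt (fun x : ℝ => ψ (-Real.log x)) x :=
        hψ.continuousAt.comp (Real.continuousAt_log hx0.ne').neg
      refine h1.mul (ContinuousAt.inv₀ ?_ ?_)
      · exact (Complex.continuous_ofReal.pow M).continuousAt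
      · exact pow_ne_zero _ (Complex.ofReal_ne_zero.2 hx0.ne')
  obtain ⟨p, hp⟩ := exists_polynomial_near_of_continuousOn 0 (Real.exp 2) (fun x => (w x).re)
    (Complex.continuous_re.comp_continuousOn hwc) (ε / 2) (by positivity)
  obtain ⟨q, hq⟩ := exists_polynomial_near_of_continuousOn 0 (Real.exp 2) (fun x => (w x).im)
    (Complex.continuous_im.comp_continuousOn hwc) (ε / 2) (by positivity)
  set d := max (p.natDegree + 1) (q.natDegree + 1) with hd
  refine ⟨d, fun j => (p.coeff j : ℂ) + q.coeff j * Complex.I, fun t ht => ?_⟩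
  set x := Real.exp (-t) with hx
  have hx0 : 0 < x := Real.exp_pos _
  have hxI : x ∈ Icc 0 (Real.exp 2) := ⟨hx0.le, Real.exp_le_exp.2 (by linarith)⟩
  have hxc : (x : ℂ) ≠ 0 := Complex.ofReal_ne_zero.2 hx0.ne'
  have hpe : p.eval x = ∑ j ∈ Finset.range d, p.coeff j * x ^ j :=
    Polynomial.eval_eq_sum_range' (lt_of_lt_of_le (Nat.lt_succ_self _) (le_max_left _ _)) x
  have hqe : q.eval x = ∑ j ∈ Finset.range d, q.coeff j * x ^ j :=
    Polynomial.eval_eq_sum_range' (lt_of_lt_of_le (Nat.lt_succ_self _) (le_max_right _ _)) x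
  have hexp : ∀ n : ℕ, Complex.exp (-(n : ℂ) * t) = (x : ℂ) ^ n := by
    intro n
    rw [hx, Complex.ofReal_exp, ← Complex.exp_nat_mul]
    congr 1
    push_cast
    ring
  have hsum : expSum M d (fun j => (p.coeff j : ℂ) + q.coeff j * Complex.I) t =
      (x : ℂ) ^ M * (((p.eval x : ℝ) : ℂ) + ((q.eval x : ℝ) : ℂ) * Complex.I) := by
    rw [expSum, hpe, hqe]
    push_cast
    rw [Finset.sum_mul, ← Finset.sum_add_distrib, Finset.mul_sum]
    refine Finset.sum_congr rfl fun j _ => ?_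
    have := hexp (M + j)
    push_cast at this
    rw [this, pow_add]
    ring
  have hψw : ψ t = (x : ℂ) ^ M * w x := by
    simp only [hw, hx, Real.log_exp, neg_neg]
    field_simp
  have hnx : ‖(x : ℂ) ^ M‖ = Real.exp (-M * t) := by
    rw [← hexp M, norm_exp_nat_mul]
  rw [hsum, hψw, ← mul_sub, norm_mul, hnx, mul_comm]
  refine mul_le_mul_of_nonneg_right ?_ (Real.exp_pos _).le
  have hre := hp x hxI
  have him := hq x hxI
  refine (Complex.norm_le_abs_re_add_abs_im _).trans ?_
  simp only [Complex.sub_re, Complex.add_re, Complex.ofReal_re, Complex.mul_re, Complex.I_re,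
    mul_zero, Complex.ofReal_im, Complex.I_im, mul_one, sub_self, add_zero, Complex.sub_im,
    Complex.add_im, Complex.mul_im, zero_add]
  rw [abs_sub_comm _ (p.eval x), abs_sub_comm _ (q.eval x)]
  linarith

/-- Simultaneous approximation of the first `N` derivatives: the top one is approximated first, and
the antiderivatives that vanish at infinity inherit the bound because `M ≥ 1`. -/
theorem exists_expSum_near_iteratedDeriv (N : ℕ) {M : ℕ} (hM : 1 ≤ M) {ε : ℝ} (hε : 0 < ε) :
    ∀ {ψ : ℝ → ℂ}, ContDiff ℝ ∞ ψ → HasCompactSupport ψ →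
    ∃ d c, ∀ n ≤ N, ∀ t : ℝ, -2 ≤ t →
      ‖iteratedDeriv n (fun t => ψ t - expSum M d c t) t‖ ≤ ε * Real.exp (-M * t) := by
  induction N with
  | zero =>
    intro ψ hψ hc
    obtain ⟨d, c, h⟩ := exists_expSum_near hψ.continuous hc hM hε
    refine ⟨d, c, fun n hn t ht => ?_⟩
    obtain rfl : n = 0 := by omega
    simpa using h t ht
  | succ N ih =>
    intro ψ hψ hc
    have hψ' : ContDiff ℝ ∞ (deriv ψ) := (contDiff_infty_iff_deriv.1 hψ).2
    obtain ⟨d, c, h⟩ := ih hψ' hc.deriv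
    refine ⟨d, fun j => -c j / (M + j : ℕ), ?_⟩
    set u : ℝ → ℂ := fun t => ψ t - expSum M d (fun j => -c j / (M + j : ℕ)) t with hu
    have hder : ∀ t, HasDerivAt u (deriv ψ t - expSum M d c t) t := fun t =>
      ((hψ.differentiable (by simp)) t).hasDerivAt.sub (hasDerivAt_expSum hM d c t)
    have hderiv : deriv u = fun t => deriv ψ t - expSum M d c t := funext fun t => (hder t).deriv
    have hlim : Tendsto u atTop (𝓝 0) := by
      have h1 : Tendsto ψ atTop (𝓝 0) := by
        have := hc.is_zero_at_infty
        exact this.mono_left atTop_le_cocompact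
      have := h1.sub (tendsto_expSum hM d (fun j => -c j / (M + j : ℕ)))
      rwa [sub_zero] at this
    have hM' : (1 : ℝ) ≤ M := by exact_mod_cast hM
    intro n hn t ht
    rcases Nat.eq_zero_or_pos n with rfl | hn0
    · have hb : ∀ s ∈ Ioi t, ‖deriv ψ s - expSum M d c s‖ ≤ ε * Real.exp (-M * s) := by
        intro s hs
        simpa using h 0 (Nat.zero_le _) s (ht.trans (le_of_lt hs))
      have hbi : IntegrableOn (fun s : ℝ => ε * Real.exp (-M * s)) (Ioi t) :=
        (integrableOn_exp_mul_Ioi (by linarith) t).const_mul ε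
      have hint : IntegrableOn (fun s => deriv ψ s - expSum M d c s) (Ioi t) := by
        refine Integrable.mono' hbi ?_ ((ae_restrict_iff' measurableSet_Ioi).2 (ae_of_all _ hb))
        exact (hψ'.continuous.sub (contDiff_expSum M d c).continuous).aestronglyMeasurable
      have heq := integral_Ioi_of_hasDerivAt_of_tendsto' (fun s _ => hder s) hint hlim
      rw [iteratedDeriv_zero]
      have : u t = -∫ s in Ioi t, (deriv ψ s - expSum M d c s) := by rw [heq]; simp
      rw [this, norm_neg]
      refine (norm_integral_le_of_norm_le hbi
        ((ae_restrict_iff' measurableSet_Ioi).2 (ae_of_all _ hb))).trans ?_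
      rw [integral_const_mul, integral_exp_mul_Ioi (by linarith)]
      gcongr
      rw [neg_div_neg_eq]
      exact div_le_self (Real.exp_pos _).le hM'
    · obtain ⟨m, rfl⟩ : ∃ m, n = m + 1 := ⟨n - 1, by omega⟩
      rw [iteratedDeriv_succ', hderiv]
      exact h m (by omega) t ht

/-! ### Determination of a distribution by its Laplace transform -/

/-- A tempered distribution has finite order. -/
theorem exists_seminorm_bound (l : 𝓢'(ℝ, ℂ)) : ∃ (N : ℕ) (C : ℝ), 0 ≤ C ∧ ∀ (g : 𝓢(ℝ, ℂ)) (B : ℝ),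
    0 ≤ B → (∀ k ≤ N, ∀ n ≤ N, ∀ t : ℝ, |t| ^ k * ‖iteratedDeriv n g t‖ ≤ B) → ‖l g‖ ≤ C * B := by
  obtain ⟨s, C, -, hC⟩ := Seminorm.bound_of_continuous (schwartz_withSeminorms ℂ ℝ ℂ)
    ((normSeminorm ℂ ℂ).comp (l : 𝓢(ℝ, ℂ) →ₗ[ℂ] ℂ)) (continuous_norm.comp l.continuous)
  refine ⟨s.sup (fun m => max m.1 m.2), C, C.2, fun g B hB h => (hC g).trans ?_⟩
  change (C : ℝ) * (s.sup (schwartzSeminormFamily ℂ ℝ ℂ)) g ≤ C * B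
  gcongr
  refine Seminorm.finset_sup_apply_le hB fun m hm => ?_
  have hle : max m.1 m.2 ≤ s.sup (fun m => max m.1 m.2) :=
    Finset.le_sup (f := fun m : ℕ × ℕ => max m.1 m.2) hm
  exact SchwartzMap.seminorm_le_bound' ℂ m.1 m.2 g hB
    (h m.1 ((le_max_left _ _).trans hle) m.2 ((le_max_right _ _).trans hle))

theorem SupportedInNonneg.congr {l : 𝓢'(ℝ, ℂ)} (hl : SupportedInNonneg l) {g₁ g₂ : 𝓢(ℝ, ℂ)}
    (h : ∀ t, -1 ≤ t → g₁ t = g₂ t) : l g₁ = l g₂ := by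
  rw [← sub_eq_zero, ← map_sub]
  refine hl _ ?_
  have : tsupport ⇑(g₁ - g₂) ⊆ Iic (-1) := by
    refine closure_minimal (fun t ht => ?_) isClosed_Iic
    by_contra hlt
    exact ht (by simp [h t (le_of_lt (not_le.1 hlt))])
  exact this.trans fun t ht => lt_of_le_of_lt (mem_Iic.1 ht) (by norm_num)

theorem exists_pow_mul_exp_le (k : ℕ) : ∃ A : ℝ, 0 ≤ A ∧ ∀ t : ℝ, -2 ≤ t →
    |t| ^ k * Real.exp (-t) ≤ A := by
  have hlim := Real.tendsto_pow_mul_exp_neg_atTop_nhds_zero k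
  have hcont : Continuous fun t : ℝ => |t| ^ k * Real.exp (-t) := by fun_prop
  obtain ⟨T, hT⟩ := eventually_atTop.1 (hlim.eventually_le_const zero_lt_one)
  obtain ⟨C, hC⟩ := (isCompact_Icc (a := (-2 : ℝ)) (b := max T 0)).exists_bound_of_continuousOn
    hcont.continuousOn
  refine ⟨max C 1, le_max_of_le_right zero_le_one, fun t ht => ?_⟩
  rcases le_total t (max T 0) with h | h
  · exact ((le_abs_self _).trans (hC t ⟨ht, h⟩)).trans (le_max_left _ _)
  · rw [abs_of_nonneg ((le_max_right _ _).trans h)]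
    exact (hT t ((le_max_left _ _).trans h)).trans (le_max_right _ _)

theorem laplaceKernel_apply (s : ℂ) (hs : 0 < s.re) (t : ℝ) :
    laplaceKernel s hs t = (smoothCutoff t : ℂ) * Complex.exp (-s * t) := rfl

theorem natCast_re_pos {M : ℕ} (hM : 1 ≤ M) (j : ℕ) : 0 < ((M + j : ℕ) : ℂ).re := by
  rw [Complex.natCast_re]
  exact_mod_cast (by omega)

/-- On a compactly supported test function, a tempered distribution supported in `[0, ∞)` is
determined by its Laplace transform at large integers. -/
theorem SupportedInNonneg.exists_approx {l : 𝓢'(ℝ, ℂ)} (hl : SupportedInNonneg l) {M : ℕ}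
    (hM : 1 ≤ M) (ψ : 𝓢(ℝ, ℂ)) (hψ : HasCompactSupport ψ) {ε : ℝ} (hε : 0 < ε) :
    ∃ d c, ‖l ψ - ∑ j ∈ Finset.range d,
        c j * laplaceTransform l (M + j : ℕ) (natCast_re_pos hM j)‖ ≤ ε ∧
      ∀ t : ℝ, 0 ≤ t → ‖ψ t - expSum M d c t‖ ≤ ε * Real.exp (-M * t) := by
  obtain ⟨N, C, hC, hbound⟩ := exists_seminorm_bound l
  obtain ⟨A, hA, hcut⟩ := exists_bound_iteratedDeriv_smoothCutoff N
  have hpow : ∃ P : ℝ, 0 ≤ P ∧ ∀ k ≤ N, ∀ t : ℝ, -2 ≤ t → |t| ^ k * Real.exp (-t) ≤ P := by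
    choose P hP0 hP using exists_pow_mul_exp_le
    exact ⟨∑ k ∈ Finset.range (N + 1), P k, Finset.sum_nonneg fun k _ => hP0 k,
      fun k hk t ht => (hP k t ht).trans (Finset.single_le_sum (f := P) (fun k _ => hP0 k)
        (Finset.mem_range.2 (Nat.lt_succ_of_le hk)))⟩
  obtain ⟨P, hP, hpow⟩ := hpow
  -- `δ` is small enough to absorb all the constants
  set K := Real.exp (2 * M) * (C * (2 ^ N * A * P)) with hK
  have hK0 : 0 ≤ K := by positivity
  set δ := ε / (1 + K) with hδ
  have hδ0 : 0 < δ := by positivity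
  have hδε : δ ≤ ε := div_le_self hε.le (by linarith)
  obtain ⟨d, c, happ⟩ := exists_expSum_near_iteratedDeriv N hM hδ0 (ψ.smooth ⊤) hψ
  refine ⟨d, c, ?_, fun t ht => ?_⟩
  · have hcs : HasCompactSupport fun t => (smoothCutoff t : ℂ) * ψ t := hψ.mul_left
    set χψ : 𝓢(ℝ, ℂ) := hcs.toSchwartzMap (contDiff_smoothCutoff.mul (ψ.smooth ⊤)) with hχψ
    have h1 : l ψ = l χψ := by
      refine hl.congr fun t ht => ?_
      change ψ t = (smoothCutoff t : ℂ) * ψ t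
      simp [smoothCutoff_eq_one ht]
    have h2 : ∑ j ∈ Finset.range d, c j * laplaceTransform l (M + j : ℕ) (natCast_re_pos hM j) =
        l (∑ j ∈ Finset.range d, c j • laplaceKernel (M + j : ℕ) (natCast_re_pos hM j)) := by
      simp [laplaceTransform, map_sum]
    rw [h1, h2, ← map_sub]
    set g := χψ - ∑ j ∈ Finset.range d, c j • laplaceKernel (M + j : ℕ) (natCast_re_pos hM j)
      with hg
    have hgf : (g : ℝ → ℂ) = fun t => (smoothCutoff t : ℂ) * (ψ t - expSum M d c t) := by
      funext t
      have : χψ t = (smoothCutoff t : ℂ) * ψ t := rfl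
      simp only [hg, sub_apply, this, sum_apply, smul_apply,
        laplaceKernel_apply, expSum, smul_eq_mul, mul_sub, Finset.mul_sum]
      congr 1
      exact Finset.sum_congr rfl fun j _ => by ring
    have hsm : ContDiff ℝ ∞ fun t => ψ t - expSum M d c t :=
      (ψ.smooth ⊤).sub (contDiff_expSum M d c)
    have hB := hbound g (2 ^ N * A * P * (Real.exp (2 * M) * δ)) (by positivity) ?_
    · refine hB.trans ?_
      have : C * (2 ^ N * A * P * (Real.exp (2 * M) * δ)) = K * δ := by rw [hK]; ring
      rw [this, hδ, mul_div_assoc', div_le_iff₀ (by positivity)]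
      nlinarith
    · intro k hk n hn t
      rw [hgf]
      rcases lt_or_ge t (-2) with ht | ht
      · have : (fun t => (smoothCutoff t : ℂ) * (ψ t - expSum M d c t)) =ᶠ[𝓝 t] fun _ => 0 := by
          filter_upwards [eventually_lt_nhds ht] with u hu
          simp [smoothCutoff_eq_zero hu.le]
        rw [this.iteratedDeriv_eq n]
        simp
        positivity
      · have hle := norm_iteratedDeriv_mul_le_of_le contDiff_smoothCutoff hsm
          (fun n hn => hcut n hn t) (fun n hn => happ n hn t ht) n hn
        have h2n : (2 : ℝ) ^ n ≤ 2 ^ N := pow_le_pow_right₀ one_le_two hn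
        -- since `t ≥ -2`, the weight `e^{-Mt}` is at most `e^{2M} e^{-t}`
        have hexp : Real.exp (-M * t) ≤ Real.exp (2 * M) * Real.exp (-t) := by
          rw [← Real.exp_add]
          refine Real.exp_le_exp.2 ?_
          have : (1 : ℝ) ≤ M := by exact_mod_cast hM
          nlinarith
        calc |t| ^ k * ‖iteratedDeriv n (fun t => (smoothCutoff t : ℂ) *
                (ψ t - expSum M d c t)) t‖
            ≤ |t| ^ k * (2 ^ N * (A * (δ * (Real.exp (2 * M) * Real.exp (-t))))) := by
              refine mul_le_mul_of_nonneg_left (hle.trans ?_) (by positivity)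
              gcongr
          _ = 2 ^ N * A * (|t| ^ k * Real.exp (-t)) * (Real.exp (2 * M) * δ) := by ring
          _ ≤ 2 ^ N * A * P * (Real.exp (2 * M) * δ) := by
              gcongr
              exact hpow k hk t ht
  · refine (happ 0 (Nat.zero_le _) t (by linarith)).trans ?_
    gcongr

/-- Compactly supported test functions suffice to detect zero. Multiplication by `smoothCutoff` cuts
a test function off on the left at no cost, so only a cutoff at `+∞` has to be controlled. -/
theorem SupportedInNonneg.eq_zero {l : 𝓢'(ℝ, ℂ)} (hl : SupportedInNonneg l)
    (h : ∀ ψ : 𝓢(ℝ, ℂ), HasCompactSupport ψ → l ψ = 0) : l = 0 := by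
  obtain ⟨N, C, hC, hbound⟩ := exists_seminorm_bound l
  obtain ⟨A, hA, hcut⟩ := exists_bound_iteratedDeriv_smoothCutoff N
  ext ψ
  change l ψ = 0
  obtain ⟨S, hS0, hS⟩ : ∃ S : ℝ, 0 ≤ S ∧ ∀ k ≤ N + 1, ∀ n ≤ N, ∀ t : ℝ,
      |t| ^ k * ‖iteratedDeriv n ψ t‖ ≤ S := by
    refine ⟨∑ k ∈ Finset.range (N + 2), ∑ n ∈ Finset.range (N + 1), SchwartzMap.seminorm ℂ k n ψ,
      Finset.sum_nonneg fun k _ => Finset.sum_nonneg fun n _ => apply_nonneg _ _,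
      fun k hk n hn t => (SchwartzMap.le_seminorm' ℂ k n ψ t).trans ?_⟩
    refine (Finset.single_le_sum (f := fun n => SchwartzMap.seminorm ℂ k n ψ)
      (fun n _ => apply_nonneg _ _) (Finset.mem_range.2 (Nat.lt_succ_of_le hn))).trans ?_
    exact Finset.single_le_sum
      (f := fun k => ∑ n ∈ Finset.range (N + 1), SchwartzMap.seminorm ℂ k n ψ)
      (fun k _ => Finset.sum_nonneg fun n _ => apply_nonneg _ _)
      (Finset.mem_range.2 (Nat.lt_succ_of_le hk))
  -- cutting `ψ` off beyond `R` changes `l ψ` by `O(1 / R)`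
  have key : ∀ R : ℝ, 1 ≤ R → ‖l ψ‖ ≤ C * (2 ^ N * (A * S)) / R := by
    intro R hR
    have hR0 : 0 < R := by linarith
    set τ : ℝ → ℂ := fun t => (smoothCutoff (t - (R + 2)) : ℂ) with hτ
    have hτs : ContDiff ℝ ∞ τ := contDiff_smoothCutoff.comp (contDiff_id.sub contDiff_const)
    have hcs : HasCompactSupport fun t => (smoothCutoff t : ℂ) * (1 - τ t) * ψ t := by
      refine HasCompactSupport.of_support_subset_isCompact (isCompact_Icc (a := (-2 : ℝ))
        (b := R + 2)) fun t ht => ?_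
      by_contra hn
      refine ht ?_
      rw [mem_Icc, not_and_or, not_le, not_le] at hn
      rcases hn with hn | hn
      · simp [smoothCutoff_eq_zero hn.le]
      · simp [hτ, smoothCutoff_eq_one (show -1 ≤ t - (R + 2) by linarith)]
    set ψ₁ : 𝓢(ℝ, ℂ) := hcs.toSchwartzMap
      ((contDiff_smoothCutoff.mul (contDiff_const.sub hτs)).mul (ψ.smooth ⊤)) with hψ₁
    have hψ₁a : ∀ t, ψ₁ t = (smoothCutoff t : ℂ) * (1 - τ t) * ψ t := fun t => rfl
    have hτg : ∀ n ≤ N, ∀ t, ‖iteratedDeriv n τ t‖ ≤ A := by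
      intro n hn t
      have := iteratedDeriv_comp_sub_const (𝕜 := ℝ) n (fun t => (smoothCutoff t : ℂ)) (R + 2)
      rw [hτ, this]
      exact hcut n hn _
    have hτ0 : Function.HasTemperateGrowth τ := by
      refine ⟨hτs, fun n => ?_⟩
      obtain ⟨A', -, hA'⟩ := exists_bound_iteratedDeriv_smoothCutoff n
      refine ⟨0, A', fun t => ?_⟩
      rw [norm_iteratedFDeriv_eq_norm_iteratedDeriv]
      have := iteratedDeriv_comp_sub_const (𝕜 := ℝ) n (fun t => (smoothCutoff t : ℂ)) (R + 2)
      rw [hτ, this]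
      simpa using hA' n le_rfl _
    set g : 𝓢(ℝ, ℂ) := SchwartzMap.smulLeftCLM ℂ τ ψ with hg
    have hga : ∀ t, g t = τ t * ψ t := fun t => by
      rw [hg, SchwartzMap.smulLeftCLM_apply_apply hτ0, smul_eq_mul]
    have h1 : l ψ = l (ψ₁ + g) := by
      refine hl.congr fun t ht => ?_
      rw [add_apply, hψ₁a, hga, smoothCutoff_eq_one ht]
      push_cast
      ring
    rw [h1, map_add, h ψ₁ hcs, zero_add, mul_div_assoc]
    refine hbound g _ (by positivity) fun k hk n hn t => ?_
    rw [show (g : ℝ → ℂ) = fun t => τ t * ψ t from funext hga]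
    rcases lt_or_ge t R with ht | ht
    · have : (fun t => τ t * ψ t) =ᶠ[𝓝 t] fun _ => 0 := by
        filter_upwards [eventually_lt_nhds ht] with u hu
        simp [hτ, smoothCutoff_eq_zero (show u - (R + 2) ≤ -2 by linarith)]
      rw [this.iteratedDeriv_eq n]
      simp
      positivity
    · have ht0 : 0 < t := by linarith
      have hb : ∀ n ≤ N, ‖iteratedDeriv n ψ t‖ ≤ S / |t| ^ (k + 1) := by
        intro n hn
        rw [le_div_iff₀ (by positivity), mul_comm]
        exact hS (k + 1) (by omega) n hn t
      have hle := norm_iteratedDeriv_mul_le_of_le hτs (ψ.smooth ⊤)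
          (fun n hn => hτg n hn t) hb n hn
      have h2n : (2 : ℝ) ^ n ≤ 2 ^ N := pow_le_pow_right₀ one_le_two hn
      calc |t| ^ k * ‖iteratedDeriv n (fun t => τ t * ψ t) t‖
          ≤ |t| ^ k * (2 ^ N * (A * (S / |t| ^ (k + 1)))) := by
            refine mul_le_mul_of_nonneg_left (hle.trans ?_) (by positivity)
            gcongr
        _ = 2 ^ N * (A * S) / |t| := by
            have : |t| ≠ 0 := by positivity
            rw [pow_succ]
            field_simp
        _ ≤ 2 ^ N * (A * S) / R := by
            rw [abs_of_pos ht0]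
            gcongr
  have hlim : Tendsto (fun R : ℝ => C * (2 ^ N * (A * S)) / R) atTop (𝓝 0) :=
    tendsto_const_nhds.div_atTop tendsto_id
  have : ‖l ψ‖ ≤ 0 := ge_of_tendsto hlim ((eventually_ge_atTop 1).mono key)
  simpa using this

theorem SupportedInNonneg.eq_zero_of_laplaceTransform {l : 𝓢'(ℝ, ℂ)} (hl : SupportedInNonneg l)
    (h : ∀ s hs, laplaceTransform l s hs = 0) : l = 0 := by
  refine hl.eq_zero fun ψ hψ => ?_
  have key : ∀ ε : ℝ, 0 < ε → ‖l ψ‖ ≤ 0 + ε := by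
    intro ε hε
    obtain ⟨d, c, h1, -⟩ := hl.exists_approx le_rfl ψ hψ hε
    simpa [h] using h1
  simpa using le_of_forall_pos_le_add key

/-- A function whose Laplace transform agrees with that of `l` at all integers `≥ M` represents `l`,
even if it is not known to be tempered. -/
theorem SupportedInNonneg.isRepresentedBy {l : 𝓢'(ℝ, ℂ)} (hl : SupportedInNonneg l) {M : ℕ}
    (hM : 1 ≤ M) {f : ℝ → ℂ} (hf0 : ∀ t < 0, f t = 0)
    (hfi : Integrable fun t : ℝ => f t * Complex.exp (-(M : ℂ) * t))
    (hf : ∀ j : ℕ, ∫ t : ℝ, f t * Complex.exp (-((M + j : ℕ) : ℂ) * t) =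
      laplaceTransform l (M + j : ℕ) (natCast_re_pos hM j)) :
    IsRepresentedBy l f := by
  intro ψ hψ
  have hmeas : AEStronglyMeasurable f := by
    have h1 : Continuous fun t : ℝ => Complex.exp ((M : ℂ) * t) := by fun_prop
    refine (hfi.aestronglyMeasurable.mul h1.aestronglyMeasurable).congr (ae_of_all _ fun t => ?_)
    change f t * Complex.exp (-(M : ℂ) * t) * Complex.exp ((M : ℂ) * t) = f t
    rw [mul_assoc, ← Complex.exp_add]
    simp
  have hdom : ∀ (g : ℝ → ℂ) (B : ℝ), Continuous g →
      (∀ t : ℝ, 0 ≤ t → ‖g t‖ ≤ B * Real.exp (-M * t)) →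
      Integrable (fun t => f t * g t) ∧
      ‖∫ t, f t * g t‖ ≤ B * ∫ t : ℝ, ‖f t * Complex.exp (-(M : ℂ) * t)‖ := by
    intro g B hg hB
    have hle : ∀ t, ‖f t * g t‖ ≤ B * ‖f t * Complex.exp (-(M : ℂ) * t)‖ := by
      intro t
      rcases lt_or_ge t 0 with ht | ht
      · simp [hf0 t ht]
      · rw [norm_mul, norm_mul, norm_exp_nat_mul]
        nlinarith [hB t ht, norm_nonneg (f t)]
    refine ⟨Integrable.mono' (hfi.norm.const_mul B)
      (hmeas.mul hg.aestronglyMeasurable) (ae_of_all _ hle), ?_⟩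
    rw [← integral_const_mul]
    exact norm_integral_le_of_norm_le (hfi.norm.const_mul B) (ae_of_all _ hle)
  have hexp : ∀ j : ℕ, Integrable fun t : ℝ => f t * Complex.exp (-((M + j : ℕ) : ℂ) * t) := by
    intro j
    refine (hdom _ 1 (by fun_prop) fun t ht => ?_).1
    rw [norm_exp_nat_mul, one_mul]
    refine Real.exp_le_exp.2 ?_
    push_cast
    nlinarith [mul_nonneg (Nat.cast_nonneg (α := ℝ) j) ht]
  set L := ∫ t : ℝ, ‖f t * Complex.exp (-(M : ℂ) * t)‖ with hL
  have hL0 : 0 ≤ L := integral_nonneg fun t => norm_nonneg _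
  have key : ∀ ε : ℝ, 0 < ε → ‖l ψ - ∫ t, f t * ψ t‖ ≤ 0 + ε := by
    intro ε hε
    set η := ε / (1 + L) with hη
    have hη0 : 0 < η := by positivity
    obtain ⟨d, c, h1, h2⟩ := hl.exists_approx hM ψ hψ hη0
    have hES : Integrable (fun t => f t * expSum M d c t) ∧ ∫ t, f t * expSum M d c t =
        ∑ j ∈ Finset.range d, c j * laplaceTransform l (M + j : ℕ) (natCast_re_pos hM j) := by
      have : (fun t => f t * expSum M d c t) = fun t : ℝ => ∑ j ∈ Finset.range d,
          c j * (f t * Complex.exp (-((M + j : ℕ) : ℂ) * t)) := by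
        funext t
        rw [expSum, Finset.mul_sum]
        exact Finset.sum_congr rfl fun j _ => by ring
      rw [this]
      refine ⟨integrable_finsetSum _ fun j _ => (hexp j).const_mul _, ?_⟩
      rw [integral_finsetSum _ fun j _ => (hexp j).const_mul _]
      exact Finset.sum_congr rfl fun j _ => by rw [integral_const_mul, hf j]
    obtain ⟨hi, hle⟩ := hdom (fun t => ψ t - expSum M d c t) η
      (ψ.continuous.sub (contDiff_expSum M d c).continuous) h2
    have hψi : Integrable fun t => f t * ψ t := by
      refine (hi.add hES.1).congr (ae_of_all _ fun t => ?_)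
      simp only [Pi.add_apply]
      ring
    have heq : ∫ t, f t * (ψ t - expSum M d c t) = (∫ t, f t * ψ t) -
        ∑ j ∈ Finset.range d, c j * laplaceTransform l (M + j : ℕ) (natCast_re_pos hM j) := by
      rw [← hES.2, ← integral_sub hψi hES.1]
      simp only [mul_sub]
    rw [heq] at hle
    have h3 : η + η * L = ε := by rw [hη]; field_simp
    have h4 := norm_sub_le_norm_sub_add_norm_sub (l ψ) (∑ j ∈ Finset.range d,
      c j * laplaceTransform l (M + j : ℕ) (natCast_re_pos hM j)) (∫ t, f t * ψ t)
    rw [norm_sub_rev (∑ j ∈ Finset.range d, _)] at h4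
    linarith
  have := le_of_forall_pos_le_add key
  rw [norm_le_zero_iff, sub_eq_zero] at this
  exact this

/-! ### Contour shift and functions of polynomial growth -/

theorem integral_vertical_eq_of_decay {Φ : ℂ → ℂ} {σ₁ σ₂ : ℝ} (hσ : σ₁ ≤ σ₂)
    (hd : DifferentiableOn ℂ Φ {s | s.re ∈ Icc σ₁ σ₂}) {B : ℝ}
    (hB : ∀ σ ∈ Icc σ₁ σ₂, ∀ y : ℝ, ‖Φ (σ + y * Complex.I)‖ ≤ B * (1 + y ^ 2)⁻¹) :
    ∫ y : ℝ, Φ (σ₁ + y * Complex.I) = ∫ y : ℝ, Φ (σ₂ + y * Complex.I) := by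
  have hint : ∀ σ ∈ Icc σ₁ σ₂, Integrable fun y : ℝ => Φ (σ + y * Complex.I) := by
    intro σ hσ
    refine Integrable.mono' (integrable_inv_one_add_sq.const_mul B) ?_ (ae_of_all _ (hB σ hσ))
    refine Continuous.aestronglyMeasurable ?_
    refine hd.continuousOn.comp_continuous (by fun_prop) fun y => ?_
    simpa using hσ
  have h1 := intervalIntegral_tendsto_integral (hint σ₁ (left_mem_Icc.2 hσ))
    tendsto_neg_atTop_atBot tendsto_id
  have h2 := intervalIntegral_tendsto_integral (hint σ₂ (right_mem_Icc.2 hσ))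
    tendsto_neg_atTop_atBot tendsto_id
  refine tendsto_nhds_unique h1 ?_
  have hdiff : Tendsto (fun Y : ℝ => (∫ y in (-Y)..Y, Φ (σ₂ + y * Complex.I)) -
      ∫ y in (-Y)..Y, Φ (σ₁ + y * Complex.I)) atTop (𝓝 0) := by
    have hle : ∀ Y : ℝ, ‖(∫ y in (-Y)..Y, Φ (σ₂ + y * Complex.I)) -
        ∫ y in (-Y)..Y, Φ (σ₁ + y * Complex.I)‖ ≤ 2 * (B * (1 + Y ^ 2)⁻¹ * |σ₂ - σ₁|) := by
      intro Y
      have hrect := Complex.integral_boundary_rect_eq_zero_of_differentiableOn Φ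
        (σ₁ + (-Y : ℝ) * Complex.I) (σ₂ + Y * Complex.I) (hd.mono ?_)
      · simp only [Complex.add_re, Complex.ofReal_re, Complex.mul_re, Complex.I_re, mul_zero,
          Complex.ofReal_im, Complex.I_im, mul_one, sub_self, add_zero, Complex.add_im,
          Complex.mul_im, zero_add] at hrect
        have hedge : ∀ y : ℝ, |y| = |Y| →
            ‖∫ x in σ₁..σ₂, Φ (x + y * Complex.I)‖ ≤ B * (1 + Y ^ 2)⁻¹ * |σ₂ - σ₁| := by
          intro y hy
          refine intervalIntegral.norm_integral_le_of_norm_le_const fun x hx => ?_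
          rw [uIoc_of_le hσ] at hx
          refine (hB x (Ioc_subset_Icc_self hx) y).trans (le_of_eq ?_)
          rw [(sq_eq_sq_iff_abs_eq_abs _ _).2 hy]
        have e1 := hedge (-Y) (abs_neg Y)
        have e2 := hedge Y rfl
        have heq : (∫ y in (-Y)..Y, Φ (σ₂ + y * Complex.I)) -
            (∫ y in (-Y)..Y, Φ (σ₁ + y * Complex.I)) =
            Complex.I * ((∫ x in σ₁..σ₂, Φ (x + (-Y : ℝ) * Complex.I)) -
              ∫ x in σ₁..σ₂, Φ (x + Y * Complex.I)) := by
          simp only [smul_eq_mul] at hrect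
          linear_combination (-Complex.I) * hrect + ((∫ y in (-Y)..Y, Φ (σ₂ + y * Complex.I)) -
            (∫ y in (-Y)..Y, Φ (σ₁ + y * Complex.I))) * Complex.I_sq
        rw [heq, norm_mul, Complex.norm_I, one_mul]
        refine (norm_sub_le _ _).trans ?_
        linarith
      · intro s hs
        have := hs.1
        simpa [uIcc_of_le hσ] using this
    refine squeeze_zero_norm hle ?_
    have : Tendsto (fun Y : ℝ => (1 + Y ^ 2)⁻¹) atTop (𝓝 0) :=
      tendsto_inv_atTop_zero.comp (tendsto_atTop_add_const_left _ _ (tendsto_pow_atTop two_ne_zero))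
    simpa using ((this.const_mul B).mul_const |σ₂ - σ₁|).const_mul 2
  simpa using h2.sub hdiff

theorem exists_temperedDistribution_of_polynomial_bound {h : ℝ → ℂ} (hc : Continuous h) {C : ℝ}
    {m : ℕ} (hb : ∀ t, ‖h t‖ ≤ C * (1 + ‖t‖) ^ m) :
    ∃ T : 𝓢'(ℝ, ℂ), ∀ ψ : 𝓢(ℝ, ℂ), T ψ = ∫ t, h t * ψ t := by
  have hC : 0 ≤ C := by
    have := (norm_nonneg _).trans (hb 0)
    simpa using this
  have hJ : Integrable fun t : ℝ => (1 + ‖t‖) ^ (-2 : ℝ) :=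
    integrable_one_add_norm (by simp)
  have hle : ∀ (ψ : 𝓢(ℝ, ℂ)) (t : ℝ), ‖h t * ψ t‖ ≤ (C * (2 ^ (m + 2) *
      (Finset.Iic (m + 2, 0)).sup (fun m => SchwartzMap.seminorm ℂ m.1 m.2) ψ)) *
        (1 + ‖t‖) ^ (-2 : ℝ) := by
    intro ψ t
    have h1 := SchwartzMap.one_add_le_sup_seminorm_apply (𝕜 := ℂ) (m := (m + 2, 0)) (k := m + 2)
      (n := 0) le_rfl le_rfl ψ t
    rw [norm_iteratedFDeriv_zero] at h1
    have h0 : (0 : ℝ) < 1 + ‖t‖ := by positivity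
    rw [norm_mul, Real.rpow_neg h0.le, ← div_eq_mul_inv, le_div_iff₀ (by positivity),
      show ((2 : ℝ)) = ((2 : ℕ) : ℝ) by norm_num, Real.rpow_natCast]
    calc ‖h t‖ * ‖ψ t‖ * (1 + ‖t‖) ^ 2 ≤ C * (1 + ‖t‖) ^ m * ‖ψ t‖ * (1 + ‖t‖) ^ 2 := by
          gcongr; exact hb t
      _ = C * ((1 + ‖t‖) ^ (m + 2) * ‖ψ t‖) := by ring
      _ ≤ _ := by push_cast; gcongr
  have hi : ∀ ψ : 𝓢(ℝ, ℂ), Integrable fun t => h t * ψ t := fun ψ =>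
    Integrable.mono' (hJ.const_mul _) (hc.mul ψ.continuous).aestronglyMeasurable
      (ae_of_all _ (hle ψ))
  let T : 𝓢(ℝ, ℂ) →L[ℂ] ℂ := SchwartzMap.mkCLMtoNormedSpace (σ := RingHom.id ℂ)
    (fun ψ => ∫ t, h t * ψ t)
    (fun f g => by
      rw [← integral_add (hi f) (hi g)]
      simp only [add_apply, mul_add])
    (fun a f => by
      simp only [smul_apply, smul_eq_mul, RingHom.id_apply]
      rw [← integral_const_mul]
      exact integral_congr_ae (ae_of_all _ fun t => by ring))
    (by
      refine ⟨Finset.Iic (m + 2, 0), C * 2 ^ (m + 2) * ∫ t : ℝ, (1 + ‖t‖) ^ (-2 : ℝ), ?_,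
        fun ψ => ?_⟩
      · have : 0 ≤ ∫ t : ℝ, (1 + ‖t‖) ^ (-2 : ℝ) := integral_nonneg fun t => by positivity
        positivity
      · refine (norm_integral_le_of_norm_le (hJ.const_mul _) (ae_of_all _ (hle ψ))).trans
          (le_of_eq ?_)
        rw [integral_const_mul]
        unfold schwartzSeminormFamily
        ring)
  exact ⟨ContinuousLinearMap.toPointwiseConvergenceCLM _ _ _ _ T, fun ψ => rfl⟩

/-! ### Existence of inverse Laplace transforms -/

open Complex FourierTransform in
/-- The inverse Laplace transform of a holomorphic function with quadratic decay on vertical lines,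
given by the Bromwich integral `(2π)⁻¹ ∫ H(σ + iy) e^{(σ + iy)t} dy`. -/
theorem exists_inverse_laplace_function {H : ℂ → ℂ} (hH : DifferentiableOn ℂ H {s | 0 < s.re})
    {C : ℝ} (hC : 0 ≤ C) {m : ℕ}
    (hb : ∀ σ : ℝ, 0 < σ → ∀ y : ℝ, ‖H (σ + y * I)‖ ≤ C / (min 1 σ) ^ m * (1 + y ^ 2)⁻¹) :
    ∃ h : ℝ → ℂ, Continuous h ∧ (∀ t < 0, h t = 0) ∧ (∃ D, ∀ t, ‖h t‖ ≤ D * (1 + ‖t‖) ^ m) ∧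
      ∀ s : ℂ, 0 < s.re → Integrable (fun t : ℝ => h t * exp (-s * t)) ∧
        ∫ t : ℝ, h t * exp (-s * t) = H s := by
  set J : ℝ → ℝ → ℂ := fun σ t => ∫ y : ℝ, H (σ + y * I) * exp ((σ + y * I) * t) with hJ
  have hHc : ∀ σ : ℝ, 0 < σ → Continuous fun y : ℝ => H (σ + y * I) := fun σ hσ =>
    hH.continuousOn.comp_continuous (by fun_prop) fun y => by simpa using hσ
  have hHi : ∀ σ : ℝ, 0 < σ → Integrable fun y : ℝ => H (σ + y * I) := fun σ hσ =>
    Integrable.mono' (integrable_inv_one_add_sq.const_mul _) (hHc σ hσ).aestronglyMeasurable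
      (ae_of_all _ (hb σ hσ))
  have hexp : ∀ σ y t : ℝ, ‖exp ((σ + y * I) * t)‖ = Real.exp (σ * t) := by
    intro σ y t
    rw [norm_exp]
    simp
  have hshift : ∀ σ₁ σ₂ : ℝ, 0 < σ₁ → σ₁ ≤ σ₂ → ∀ t, J σ₁ t = J σ₂ t := by
    intro σ₁ σ₂ h1 h12 t
    refine integral_vertical_eq_of_decay (Φ := fun s => H s * exp (s * t)) h12 ?_
      (B := C / (min 1 σ₁) ^ m * Real.exp ((|σ₁| + |σ₂|) * |t|)) fun σ hσ y => ?_
    · refine (hH.mono fun s hs => lt_of_lt_of_le h1 hs.1).mul ?_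
      exact (differentiable_id.mul_const _).cexp.differentiableOn
    · have hσ0 : 0 < σ := h1.trans_le hσ.1
      rw [norm_mul, hexp]
      have e1 : min 1 σ₁ ≤ min 1 σ := min_le_min_left _ hσ.1
      have e2 : 0 < min 1 σ₁ := lt_min one_pos h1
      have e3 : σ * t ≤ (|σ₁| + |σ₂|) * |t| := by
        rw [abs_of_pos h1, abs_of_pos (h1.trans_le h12)]
        have := le_abs_self t
        have := abs_nonneg t
        nlinarith [hσ.2]
      calc ‖H (σ + y * I)‖ * Real.exp (σ * t)
          ≤ (C / (min 1 σ) ^ m * (1 + y ^ 2)⁻¹) * Real.exp (σ * t) := by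
            gcongr; exact hb σ hσ0 y
        _ ≤ (C / (min 1 σ₁) ^ m * (1 + y ^ 2)⁻¹) * Real.exp ((|σ₁| + |σ₂|) * |t|) := by gcongr
        _ = _ := by ring
  have hJ1 : ∀ σ : ℝ, 0 < σ → ∀ t, J 1 t = J σ t := by
    intro σ hσ t
    rcases le_total 1 σ with h | h
    · exact hshift 1 σ one_pos h t
    · exact (hshift σ 1 hσ h t).symm
  have hJb : ∀ σ : ℝ, 0 < σ → ∀ t, ‖J 1 t‖ ≤ C / (min 1 σ) ^ m * Real.pi * Real.exp (σ * t) := by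
    intro σ hσ t
    rw [hJ1 σ hσ t]
    refine (norm_integral_le_of_norm_le ((integrable_inv_one_add_sq.const_mul
      (C / (min 1 σ) ^ m)).mul_const (Real.exp (σ * t))) (ae_of_all _ fun y => ?_)).trans
      (le_of_eq ?_)
    · rw [norm_mul, hexp]
      gcongr
      exact hb σ hσ y
    · rw [integral_mul_const, integral_const_mul, integral_univ_inv_one_add_sq]
  have hJc : Continuous (J 1) := by
    have : J 1 = fun t : ℝ => (∫ y : ℝ, H ((1 : ℝ) + y * I) * exp (y * I * t)) * exp t := by
      funext t
      rw [hJ, ← integral_mul_const]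
      refine integral_congr_ae (ae_of_all _ fun y => ?_)
      simp only
      rw [mul_assoc, ← exp_add]
      congr 2
      push_cast
      ring
    rw [this]
    refine Continuous.mul ?_ (by fun_prop)
    refine continuous_of_dominated (bound := fun y => ‖H ((1 : ℝ) + y * I)‖) (fun t => ?_)
      (fun t => ae_of_all _ fun y => ?_) (hHi 1 one_pos).norm (ae_of_all _ fun y => by fun_prop)
    · exact ((hHc 1 one_pos).mul (by fun_prop)).aestronglyMeasurable
    · rw [norm_mul, norm_exp]
      simp
  have hJ0 : ∀ t < 0, J 1 t = 0 := by
    intro t ht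
    have hlim : Tendsto (fun σ : ℝ => C * Real.pi * Real.exp (σ * t)) atTop (𝓝 (C * Real.pi * 0)) :=
      (Real.tendsto_exp_atBot.comp (tendsto_id.atTop_mul_const_of_neg ht)).const_mul _
    rw [mul_zero] at hlim
    have : ‖J 1 t‖ ≤ 0 := ge_of_tendsto hlim <| (eventually_ge_atTop 1).mono fun σ hσ => by
      have := hJb σ (by linarith) t
      rwa [min_eq_left hσ, one_pow, div_one] at this
    simpa using this
  have hπ : (0 : ℝ) < (2 * Real.pi)⁻¹ := by positivity
  set h : ℝ → ℂ := fun t => ((2 * Real.pi)⁻¹ : ℝ) * J 1 t with hh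
  have hhn : ∀ t, ‖h t‖ = (2 * Real.pi)⁻¹ * ‖J 1 t‖ := fun t => by
    rw [hh, norm_mul, norm_real, Real.norm_of_nonneg hπ.le]
  have hhc : Continuous h := continuous_const.mul hJc
  have hh0 : ∀ t < 0, h t = 0 := fun t ht => by simp [hh, hJ0 t ht]
  refine ⟨h, hhc, hh0, ⟨(2 * Real.pi)⁻¹ * (C * Real.pi * Real.exp 1), fun t => ?_⟩, fun s hs => ?_⟩
  · rcases lt_or_ge t 0 with ht | ht
    · rw [hh0 t ht, norm_zero]
      positivity
    · -- the optimal abscissa for a given time `t` is of order `1 / t`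
      have h1 : 0 < (1 + t)⁻¹ := by positivity
      have h2 := hJb (1 + t)⁻¹ h1 t
      rw [min_eq_right (inv_le_one_of_one_le₀ (by linarith)), inv_pow, div_inv_eq_mul] at h2
      rw [hhn, Real.norm_of_nonneg ht, mul_assoc]
      gcongr
      refine h2.trans ?_
      have h3 : (1 + t)⁻¹ * t ≤ 1 := by
        rw [inv_mul_le_iff₀ (by linarith)]
        linarith
      calc C * (1 + t) ^ m * Real.pi * Real.exp ((1 + t)⁻¹ * t)
          ≤ C * (1 + t) ^ m * Real.pi * Real.exp 1 := by gcongr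
        _ = _ := by ring
  · have hint : ∀ s : ℂ, 0 < s.re → Integrable fun t : ℝ => h t * exp (-s * t) := by
      intro s hs
      set σ := s.re with hσ
      set K := (2 * Real.pi)⁻¹ * (C / (min 1 (σ / 2)) ^ m * Real.pi) with hK
      have hmin : 0 < min 1 (σ / 2) := lt_min one_pos (by positivity)
      have hi : Integrable ((Ici 0).indicator fun t : ℝ => K * Real.exp (-(σ / 2) * t)) := by
        rw [integrable_indicator_iff measurableSet_Ici, integrableOn_Ici_iff_integrableOn_Ioi]
        exact (integrableOn_exp_mul_Ioi (by linarith) 0).const_mul K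
      refine Integrable.mono' hi (hhc.mul (by fun_prop)).aestronglyMeasurable
        (ae_of_all _ fun t => ?_)
      rcases lt_or_ge t 0 with ht | ht
      · simp [hh0 t ht, indicator, not_le.2 ht]
      · rw [indicator_of_mem (mem_Ici.2 ht), norm_mul, hhn, norm_exp]
        have e1 : (-s * (t : ℂ)).re = -σ * t := by simp [hσ]
        rw [e1]
        calc (2 * Real.pi)⁻¹ * ‖J 1 t‖ * Real.exp (-σ * t)
            ≤ (2 * Real.pi)⁻¹ * (C / (min 1 (σ / 2)) ^ m * Real.pi * Real.exp (σ / 2 * t)) *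
                Real.exp (-σ * t) := by
              gcongr
              exact hJb (σ / 2) (by positivity) t
          _ = K * (Real.exp (σ / 2 * t) * Real.exp (-σ * t)) := by rw [hK]; ring
          _ = K * Real.exp (-(σ / 2) * t) := by
              rw [← Real.exp_add]
              congr 2
              ring
    refine ⟨hint s hs, ?_⟩
    set σ := s.re with hσ
    -- on the line `Re s = σ`, this is Fourier inversion
    set g : ℝ → ℂ := fun w => H (σ + (2 * Real.pi * w : ℝ) * I) with hg
    have h2π : (2 * Real.pi) ≠ 0 := by positivity
    have hgc : Continuous g := (hHc σ hs).comp (by fun_prop : Continuous fun w => 2 * Real.pi * w)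
    have hgi : Integrable g := (hHi σ hs).comp_mul_left' h2π
    have hginv : ∀ t, 𝓕⁻ g t = h t * exp (-(σ : ℂ) * t) := by
      intro t
      have e1 : ∀ w : ℝ, exp ((2 * Real.pi * (w * t) : ℝ) * I) * g w =
          (fun y : ℝ => H (σ + y * I) * exp ((σ + y * I) * t)) (2 * Real.pi * w) *
            exp (-(σ : ℂ) * t) := by
        intro w
        simp only [hg]
        rw [mul_assoc (H _) (exp _), ← exp_add, mul_comm (exp _)]
        congr 2
        push_cast
        ring
      rw [Real.fourierInv_eq']
      simp only [smul_eq_mul, RCLike.inner_apply, conj_trivial]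
      simp only [mul_comm t, e1]
      rw [integral_mul_const,
        Measure.integral_comp_mul_left (fun y : ℝ => H (σ + y * I) * exp ((σ + y * I) * t)),
        abs_of_pos (inv_pos.2 (by positivity)), show h t = ((2 * Real.pi)⁻¹ : ℝ) * J 1 t from rfl, hJ1 σ hs t, real_smul]
    have hFg : Integrable (𝓕 g) := by
      have e2 : Integrable (𝓕⁻ g) := (hint σ (by simpa using hs)).congr
        (ae_of_all _ fun t => (hginv t).symm)
      have e3 := e2.comp_neg
      refine e3.congr (ae_of_all _ fun t => ?_)
      simp [Real.fourierInv_eq_fourier_neg]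
    have hfin := congrFun (hgc.fourier_fourierInv_eq hgi hFg) (s.im / (2 * Real.pi))
    rw [Real.fourier_real_eq_integral_exp_smul] at hfin
    have e4 : g (s.im / (2 * Real.pi)) = H s := by
      simp only [hg]
      rw [mul_div_cancel₀ _ h2π, hσ, re_add_im]
    rw [← e4, ← hfin]
    refine integral_congr_ae (ae_of_all _ fun t => ?_)
    simp only [smul_eq_mul, hginv]
    rw [mul_left_comm, ← exp_add]
    congr 2
    rw [show -2 * Real.pi * t * (s.im / (2 * Real.pi)) = -t * s.im by field_simp]
    conv_lhs => rw [← re_add_im s]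
    push_cast
    ring

/-- A holomorphic function on the right half-plane which is `O((min 1 (Re s))⁻ᵐ)` is the Laplace
transform of a tempered distribution supported in `[0, ∞)`. The division by `(1 + s)²` makes the
Bromwich integral converge, and `(1 + d/dt)²` undoes it. -/
theorem exists_isInverseLaplace {F : ℂ → ℂ} (hF : DifferentiableOn ℂ F {s | 0 < s.re}) {C : ℝ}
    {m : ℕ} (hb : ∀ s : ℂ, 0 < s.re → (min 1 s.re) ^ m * ‖F s‖ ≤ C) :
    ∃ l : 𝓢'(ℝ, ℂ), IsInverseLaplace l F := by
  have hC : 0 ≤ C := le_trans (by simp) (hb 1 (by simp))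
  have hne : ∀ s : ℂ, 0 < s.re → (1 + s) ≠ 0 := by
    intro s hs h
    have := congrArg Complex.re h
    simp at this
    linarith
  have hHd : DifferentiableOn ℂ (fun s => F s / (1 + s) ^ 2) {s | 0 < s.re} := by
    refine hF.div (by fun_prop) fun s hs => pow_ne_zero _ (hne s hs)
  have hHb : ∀ σ : ℝ, 0 < σ → ∀ y : ℝ, ‖F (σ + y * Complex.I) / (1 + (σ + y * Complex.I)) ^ 2‖ ≤
      C / (min 1 σ) ^ m * (1 + y ^ 2)⁻¹ := by
    intro σ hσ y
    have hre : ((σ : ℂ) + y * Complex.I).re = σ := by simp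
    have h1 := hb (σ + y * Complex.I) (by rwa [hre])
    rw [hre] at h1
    have hmin : 0 < min 1 σ := lt_min one_pos hσ
    have h2 : 1 + y ^ 2 ≤ ‖(1 + ((σ : ℂ) + y * Complex.I)) ^ 2‖ := by
      rw [norm_pow, ← Complex.normSq_eq_norm_sq, Complex.normSq_apply]
      simp
      nlinarith
    rw [norm_div, div_eq_mul_inv]
    gcongr
    rwa [le_div_iff₀' (by positivity)]
  obtain ⟨h, hhc, hh0, ⟨D, hD⟩, hL⟩ := exists_inverse_laplace_function hHd hC hHb
  obtain ⟨T, hT⟩ := exists_temperedDistribution_of_polynomial_bound hhc hD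
  set T' := TemperedDistribution.derivCLM ℂ T with hT'
  set T'' := TemperedDistribution.derivCLM ℂ T' with hT''
  have hval : ∀ ψ : 𝓢(ℝ, ℂ), (T + (2 : ℂ) • T' + T'') ψ = T ψ -
      2 * T (SchwartzMap.derivCLM ℂ ℂ ψ) +
      T (SchwartzMap.derivCLM ℂ ℂ (SchwartzMap.derivCLM ℂ ℂ ψ)) := by
    intro ψ
    simp [hT', hT'']
    ring
  refine ⟨T + (2 : ℂ) • T' + T'', fun ψ hψ => ?_, fun s hs => ?_⟩
  · have hz : ∀ ψ : 𝓢(ℝ, ℂ), tsupport ψ ⊆ Iio 0 → T ψ = 0 := by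
      intro ψ hψ
      rw [hT]
      refine integral_eq_zero_of_ae (ae_of_all _ fun t => ?_)
      rcases lt_or_ge t 0 with ht | ht
      · simp [hh0 t ht]
      · have : ψ t = 0 := image_eq_zero_of_notMem_tsupport fun hmem =>
          absurd (hψ hmem) (not_lt.2 ht)
        simp [this]
    have hd : ∀ ψ : 𝓢(ℝ, ℂ), tsupport (SchwartzMap.derivCLM ℂ ℂ ψ) ⊆ tsupport ψ := by
      intro ψ
      exact closure_minimal (support_deriv_subset) (isClosed_tsupport _)
    rw [hval, hz ψ hψ, hz _ ((hd ψ).trans hψ), hz _ ((hd _).trans ((hd ψ).trans hψ))]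
    simp
  · obtain ⟨hi, hint⟩ := hL s hs
    have hexp : ∀ (c : ℂ) (ψ : 𝓢(ℝ, ℂ)), (∀ t, 0 ≤ t → ψ t = c * Complex.exp (-s * t)) →
        T ψ = c * (F s / (1 + s) ^ 2) := by
      intro c ψ hψ
      rw [hT, ← hint, ← integral_const_mul]
      refine integral_congr_ae (ae_of_all _ fun t => ?_)
      rcases lt_or_ge t 0 with ht | ht
      · simp [hh0 t ht]
      · simp only [hψ t ht]
        ring
    have hder : ∀ t : ℝ, -1 < t → ∀ n, iteratedDeriv n (laplaceKernel s hs) t =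
        (-s) ^ n * Complex.exp (-s * t) := by
      intro t ht n
      have : (laplaceKernel s hs : ℝ → ℂ) =ᶠ[𝓝 t] fun t : ℝ => Complex.exp (-s * t) := by
        filter_upwards [eventually_gt_nhds ht] with u hu
        simp [laplaceKernel_apply, smoothCutoff_eq_one hu.le]
      rw [this.iteratedDeriv_eq n, iteratedDeriv_exp_neg_mul]
    rw [laplaceTransform, hval, hexp 1 _ fun t ht => ?_, hexp (-s) _ fun t ht => ?_,
      hexp ((-s) ^ 2) _ fun t ht => ?_]
    · have := hne s hs
      field_simp
      ring
    · have := hder t (by linarith) 2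
      rw [← this, iteratedDeriv_succ, iteratedDeriv_one]
      rfl
    · have := hder t (by linarith) 1
      rw [pow_one] at this
      rw [← this, iteratedDeriv_one]
      rfl
    · simpa using hder t (by linarith) 0

/-! ### Lower bounds for the symbol -/

/-- Where one power dominates all others, the symbol is comparable to that power. -/
theorem eventually_le_norm_fracSymbol {k : ℕ} (a : Fin (k + 1) → ℂ) (γ : Fin (k + 1) → ℝ)
    {L : Filter ℝ} (hL : ∀ᶠ r in L, 0 < r) {j : Fin (k + 1)} (hj : a j ≠ 0)
    (hdom : ∀ i, i ≠ j → a i ≠ 0 → Tendsto (fun r : ℝ => r ^ (γ i - γ j)) L (𝓝 0)) :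
    ∀ᶠ r in L, ∀ s : ℂ, ‖s‖ = r → ‖a j‖ / 2 * r ^ γ j ≤ ‖fracSymbol a γ s‖ := by
  have hlim : Tendsto (fun r : ℝ => ∑ i ∈ Finset.univ.erase j, ‖a i‖ * r ^ (γ i - γ j)) L
      (𝓝 (∑ i ∈ Finset.univ.erase j, 0)) := by
    refine tendsto_finsetSum _ fun i hi => ?_
    by_cases hai : a i = 0
    · simp [hai, tendsto_const_nhds]
    · simpa using (hdom i (Finset.ne_of_mem_erase hi) hai).const_mul ‖a i‖
  rw [Finset.sum_const_zero] at hlim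
  have hpos : 0 < ‖a j‖ / 2 := by positivity
  filter_upwards [hL, hlim.eventually_le_const hpos] with r hr hle s hs
  have hsum : fracSymbol a γ s = a j * s ^ (γ j : ℂ) +
      ∑ i ∈ Finset.univ.erase j, a i * s ^ (γ i : ℂ) := by
    rw [fracSymbol, Finset.add_sum_erase _ (fun i => a i * s ^ (γ i : ℂ)) (Finset.mem_univ j)]
  have h1 : ‖a j * s ^ (γ j : ℂ)‖ = ‖a j‖ * r ^ γ j := by
    rw [norm_mul, Complex.norm_cpow_real, hs]
  have h2 : ‖∑ i ∈ Finset.univ.erase j, a i * s ^ (γ i : ℂ)‖ ≤ ‖a j‖ / 2 * r ^ γ j := by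
    refine (norm_sum_le _ _).trans ?_
    refine le_trans (le_of_eq ?_) (mul_le_mul_of_nonneg_right hle (by positivity))
    rw [Finset.sum_mul]
    refine Finset.sum_congr rfl fun i _ => ?_
    rw [norm_mul, Complex.norm_cpow_real, hs, mul_assoc, ← Real.rpow_add hr, sub_add_cancel]
  have h3 := norm_sub_le_norm_add (a j * s ^ (γ j : ℂ))
    (∑ i ∈ Finset.univ.erase j, a i * s ^ (γ i : ℂ))
  rw [← hsum] at h3
  linarith

theorem analyticAt_fracSymbol {k : ℕ} (a : Fin (k + 1) → ℂ) (γ : Fin (k + 1) → ℝ) {z : ℂ}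
    (hz : z ∈ Complex.slitPlane) : AnalyticAt ℂ (fracSymbol a γ) z := by
  unfold fracSymbol
  refine Finset.analyticAt_fun_sum _ fun i _ => ?_
  exact analyticAt_const.mul (analyticAt_id.cpow analyticAt_const hz)

/-- Lower bound of the symbol on the right half-plane, in terms of the distance to the imaginary
axis. -/
theorem exists_le_norm_fracSymbol {k : ℕ} (a : Fin (k + 1) → ℂ) (γ : Fin (k + 1) → ℝ)
    (hγ : StrictAnti γ) (hγ02 : ∀ i, γ i ∈ Ico (0 : ℝ) 2) (ha : a 0 ≠ 0)
    (hA0 : ∀ s : ℂ, 0 < s.re → fracSymbol a γ s ≠ 0) :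
    ∃ (C : ℝ) (m : ℕ), ∀ s : ℂ, 0 < s.re → (min 1 s.re) ^ m ≤ C * ‖fracSymbol a γ s‖ := by
  have hmin0 : ∀ {s : ℂ}, 0 < s.re → 0 < min 1 s.re := fun hs => lt_min one_pos hs
  have hmin1 : ∀ s : ℂ, min 1 s.re ≤ 1 := fun s => min_le_left _ _
  -- at infinity the leading power dominates
  obtain ⟨R, hR⟩ : ∃ R : ℝ, ∀ s : ℂ, R ≤ ‖s‖ → ‖a 0‖ / 2 ≤ ‖fracSymbol a γ s‖ := by
    have h := eventually_le_norm_fracSymbol a γ (eventually_gt_atTop 0) ha fun i hi _ => by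
      have : 0 < γ 0 - γ i := sub_pos.2 (hγ (Fin.pos_iff_ne_zero.2 hi))
      simpa using tendsto_rpow_neg_atTop this
    obtain ⟨R, hR⟩ := eventually_atTop.1 (h.and (eventually_ge_atTop 1))
    refine ⟨R, fun s hs => ?_⟩
    obtain ⟨h1, h2⟩ := hR _ hs
    refine le_trans ?_ (h1 s rfl)
    exact le_mul_of_one_le_right (by positivity) (Real.one_le_rpow h2 (hγ02 0).1)
  -- at zero the last term with a nonzero coefficient dominates; its exponent is below `2`
  have hzero : ∃ r > 0, ∃ C : ℝ, 0 ≤ C ∧ ∀ s : ℂ, ‖s‖ < r → 0 < s.re →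
      (min 1 s.re) ^ 2 ≤ C * ‖fracSymbol a γ s‖ := by
    set S := Finset.univ.filter fun i => a i ≠ 0 with hS
    have hSne : S.Nonempty := ⟨0, by simp [hS, ha]⟩
    set j := S.max' hSne with hj
    have haj : a j ≠ 0 := (Finset.mem_filter.1 (S.max'_mem hSne)).2
    have h := eventually_le_norm_fracSymbol a γ (L := 𝓝[>] 0) (j := j) self_mem_nhdsWithin haj
      fun i hi hai => by
        have hlt : i < j := lt_of_le_of_ne (S.le_max' i (by simp [hS, hai])) hi
        have hpos : 0 < γ i - γ j := sub_pos.2 (hγ hlt)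
        have := (Real.continuousAt_rpow_const 0 (γ i - γ j) (Or.inr hpos.le)).tendsto
        rw [Real.zero_rpow hpos.ne'] at this
        exact this.mono_left nhdsWithin_le_nhds
    obtain ⟨r, hr0, hr⟩ := mem_nhdsGT_iff_exists_Ioo_subset.1 (h.and (Ioo_mem_nhdsGT one_pos))
    refine ⟨r, hr0, 2 / ‖a j‖, by positivity, fun s hs hre => ?_⟩
    have hs0 : 0 < ‖s‖ := hre.trans_le (Complex.re_le_norm s)
    obtain ⟨h1, -, h2⟩ := hr ⟨hs0, hs⟩
    have h3 := h1 s rfl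
    have h4 : ‖s‖ ^ 2 ≤ ‖s‖ ^ γ j := by
      rw [← Real.rpow_natCast]
      exact Real.rpow_le_rpow_of_exponent_ge hs0 h2.le (by exact_mod_cast (hγ02 j).2.le)
    have h5 : (min 1 s.re) ^ 2 ≤ ‖s‖ ^ 2 :=
      pow_le_pow_left₀ (hmin0 hre).le ((min_le_right _ _).trans (Complex.re_le_norm s)) 2
    rw [div_mul_eq_mul_div, le_div_iff₀ (by positivity)]
    have : 0 < ‖a j‖ := by positivity
    nlinarith
  -- the estimate is local, so compactness covers the remaining half-disc
  set K : Set ℂ := Metric.closedBall 0 R ∩ {s | 0 ≤ s.re} with hK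
  have hKc : IsCompact K :=
    (isCompact_closedBall 0 R).inter_right (isClosed_le continuous_const Complex.continuous_re)
  have hcomp : ∃ (C : ℝ) (m : ℕ), 0 ≤ C ∧
      ∀ s ∈ K, 0 < s.re → (min 1 s.re) ^ m ≤ C * ‖fracSymbol a γ s‖ := by
    refine hKc.induction_on (p := fun T => ∃ (C : ℝ) (m : ℕ), 0 ≤ C ∧
      ∀ s ∈ T, 0 < s.re → (min 1 s.re) ^ m ≤ C * ‖fracSymbol a γ s‖) ?_ ?_ ?_ ?_
    · exact ⟨0, 0, le_rfl, fun s hs => absurd hs (notMem_empty s)⟩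
    · rintro S T hST ⟨C, m, hC, h⟩
      exact ⟨C, m, hC, fun s hs => h s (hST hs)⟩
    · rintro S T ⟨C, m, hC, h⟩ ⟨C', m', hC', h'⟩
      refine ⟨C + C', max m m', by positivity, fun s hs hre => ?_⟩
      have hn := norm_nonneg (fracSymbol a γ s)
      rw [add_mul]
      rcases hs with hs | hs
      · have := h s hs hre
        have := pow_le_pow_of_le_one (hmin0 hre).le (hmin1 s) (le_max_left m m')
        nlinarith
      · have := h' s hs hre
        have := pow_le_pow_of_le_one (hmin0 hre).le (hmin1 s) (le_max_right m m')
        nlinarith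
    · intro z hz
      have hzre : 0 ≤ z.re := hz.2
      by_cases hz0 : z = 0
      · obtain ⟨r, hr, C, hC, h⟩ := hzero
        subst hz0
        refine ⟨Metric.ball 0 r, mem_nhdsWithin_of_mem_nhds (Metric.ball_mem_nhds _ hr), C, 2, hC,
          fun s hs => h s (by simpa using hs)⟩
      · have hsl : z ∈ Complex.slitPlane := by
          rcases hzre.lt_or_eq with h | h
          · exact Or.inl h
          · exact Or.inr fun him => hz0 (Complex.ext h.symm him)
        have han := analyticAt_fracSymbol a γ hsl
        rcases hzre.lt_or_eq with h | h
        · -- no zero in the open half-plane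
          have hne := norm_pos_iff.2 (hA0 z h)
          refine ⟨{s | ‖fracSymbol a γ z‖ / 2 < ‖fracSymbol a γ s‖}, mem_nhdsWithin_of_mem_nhds
            (han.continuousAt.norm.eventually_const_lt (half_lt_self hne)),
            2 / ‖fracSymbol a γ z‖, 0, by positivity, fun s hs _ => ?_⟩
          have hs' : ‖fracSymbol a γ z‖ / 2 < ‖fracSymbol a γ s‖ := hs
          rw [pow_zero, div_mul_eq_mul_div, le_div_iff₀ hne]
          linarith
        · -- on the imaginary axis a zero has finite order, and `|s - z| ≥ Re s`
          have hnz : ¬∀ᶠ s in 𝓝 z, fracSymbol a γ s = 0 := by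
            intro hev
            have htend : Tendsto (fun x : ℝ => z + x) (𝓝[>] 0) (𝓝 z) := by
              have : Continuous fun x : ℝ => z + x := by fun_prop
              simpa using (this.tendsto 0).mono_left nhdsWithin_le_nhds
            obtain ⟨x, hx, hx0⟩ := ((htend.eventually hev).and self_mem_nhdsWithin).exists
            exact hA0 (z + x) (by simpa [← h] using hx0) hx
          obtain ⟨n, g, hg, hgz, hfg⟩ := han.exists_eventuallyEq_pow_smul_nonzero_iff.2 hnz
          have hne := norm_pos_iff.2 hgz
          refine ⟨_, mem_nhdsWithin_of_mem_nhds
            (hfg.and (hg.continuousAt.norm.eventually_const_lt (half_lt_self hne))),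
            2 / ‖g z‖, n, by positivity, ?_⟩
          rintro s ⟨hs1, hs2⟩ hre
          have h1 : (min 1 s.re) ^ n ≤ ‖s - z‖ ^ n := by
            refine pow_le_pow_left₀ (hmin0 hre).le ((min_le_right _ _).trans ?_) n
            have := Complex.re_le_norm (s - z)
            rwa [Complex.sub_re, ← h, sub_zero] at this
          rw [hs1, norm_smul, norm_pow, div_mul_eq_mul_div, le_div_iff₀ hne]
          nlinarith [pow_nonneg (norm_nonneg (s - z)) n]
  obtain ⟨C, m, hC, h⟩ := hcomp
  have ha0 : 0 < ‖a 0‖ := norm_pos_iff.2 ha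
  refine ⟨C + 2 / ‖a 0‖, m, fun s hs => ?_⟩
  have hn := norm_nonneg (fracSymbol a γ s)
  rw [add_mul]
  rcases le_total ‖s‖ R with h1 | h1
  · have := h s ⟨by simpa using h1, hs.le⟩ hs
    have : 0 ≤ 2 / ‖a 0‖ * ‖fracSymbol a γ s‖ := by positivity
    linarith
  · have h2 : 1 ≤ 2 / ‖a 0‖ * ‖fracSymbol a γ s‖ := by
      rw [div_mul_eq_mul_div, le_div_iff₀ ha0]
      linarith [hR s h1]
    have h3 := pow_le_one₀ (n := m) (hmin0 hs).le (hmin1 s)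
    have : 0 ≤ C * ‖fracSymbol a γ s‖ := by positivity
    linarith

/-! ### The Neumann series -/

theorem integrable_tsum_of_summable_integral_norm {α ι : Type*} [MeasurableSpace α] {μ : Measure α}
    [Countable ι] {F : ι → α → ℂ} (hi : ∀ i, Integrable (F i) μ)
    (hs : Summable fun i => ∫ x, ‖F i x‖ ∂μ) : Integrable (fun x => ∑' i, F i x) μ := by
  have htop : ∑' i, eLpNorm (F i) 1 μ ≠ ⊤ := by
    have : ∀ i, eLpNorm (F i) 1 μ = ENNReal.ofReal (∫ x, ‖F i x‖ ∂μ) := fun i => by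
      rw [eLpNorm_one_eq_lintegral_enorm, ofReal_integral_norm_eq_lintegral_enorm (hi i)]
    simp only [this]
    exact hs.tsum_ofReal_ne_top
  have hae := summable_norm_of_tsum_eLpNorm_ne_top le_rfl (fun i => (hi i).aestronglyMeasurable)
    htop
  refine ⟨aestronglyMeasurable_of_tendsto_ae (atTop : Filter (Finset ι))
    (f := fun s x => ∑ i ∈ s, F i x)
    (fun s => (integrable_finsetSum s fun i _ => hi i).aestronglyMeasurable) ?_, ?_⟩
  · filter_upwards [hae] with x hx
    exact hx.of_norm.hasSum
  · refine lt_of_le_of_lt (lintegral_mono fun x => enorm_tsum_le_tsum_enorm) ?_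
    rw [lintegral_tsum fun i => (hi i).aestronglyMeasurable.enorm]
    simp only [eLpNorm_one_eq_lintegral_enorm] at htop
    exact htop.lt_top

/-- Geometric series of a finite sum, expanded over all finite words. -/
theorem hasSum_words {ι : Type*} [Fintype ι] (x : ι → ℂ) (hx : ∑ i, ‖x i‖ < 1) :
    (Summable fun w : Σ n, Fin n → ι => ‖∏ i, x (w.2 i)‖) ∧
    HasSum (fun w : Σ n, Fin n → ι => ∏ i, x (w.2 i)) (1 - ∑ i, x i)⁻¹ := by
  have h0 : 0 ≤ ∑ i, ‖x i‖ := Finset.sum_nonneg fun i _ => norm_nonneg _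
  have hsum : Summable fun w : Σ n, Fin n → ι => ‖∏ i, x (w.2 i)‖ := by
    rw [summable_sigma_of_nonneg fun w => norm_nonneg _]
    refine ⟨fun n => Summable.of_finite, ?_⟩
    simp only [tsum_fintype, norm_prod]
    exact (summable_geometric_of_lt_one h0 hx).congr fun n => Fintype.sum_pow (fun i => ‖x i‖) n
  refine ⟨hsum, ?_⟩
  have hlt : ‖∑ i, x i‖ < 1 := (norm_sum_le _ _).trans_lt hx
  refine HasSum.sigma_of_hasSum (hasSum_geometric_of_norm_lt_one hlt) (fun n => ?_) hsum.of_norm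
  rw [Fintype.sum_pow]
  exact hasSum_fintype _

/-- The kernel `t_+^{α-1} / Γ(α)` of fractional integration, whose Laplace transform is
`s ^ (-α)`. -/
noncomputable def powerKernel (α t : ℝ) : ℝ :=
  if 0 < t then t ^ (α - 1) / Real.Gamma α else 0

theorem powerKernel_of_nonpos (α : ℝ) {t : ℝ} (ht : t ≤ 0) : powerKernel α t = 0 :=
  if_neg (not_lt.2 ht)

theorem powerKernel_nonneg {α : ℝ} (hα : 0 < α) (t : ℝ) : 0 ≤ powerKernel α t := by
  unfold powerKernel
  split_ifs with h
  · exact div_nonneg (Real.rpow_nonneg h.le _) (Real.Gamma_pos_of_pos hα).le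
  · exact le_rfl

theorem powerKernel_mul_exp_eq_indicator (α σ : ℝ) :
    (fun t => powerKernel α t * Real.exp (-(σ * t))) =
      (Ioi 0).indicator fun t => (Real.Gamma α)⁻¹ * (t ^ (α - 1) * Real.exp (-(σ * t))) := by
  funext t
  by_cases ht : 0 < t
  · rw [indicator_of_mem (mem_Ioi.2 ht), powerKernel, if_pos ht]
    ring
  · rw [indicator_of_notMem (by simpa using ht), powerKernel, if_neg ht, zero_mul]

theorem integral_powerKernel_mul_exp {α σ : ℝ} (hα : 0 < α) (hσ : 0 < σ) :
    ∫ t, powerKernel α t * Real.exp (-(σ * t)) = σ ^ (-α) := by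
  rw [powerKernel_mul_exp_eq_indicator, integral_indicator measurableSet_Ioi, integral_const_mul,
    Real.integral_rpow_mul_exp_neg_mul_Ioi hα hσ, one_div, Real.inv_rpow hσ.le, Real.rpow_neg hσ.le]
  have := (Real.Gamma_pos_of_pos hα).ne'
  field_simp

theorem integrable_powerKernel_mul_exp {α σ : ℝ} (hα : 0 < α) (hσ : 0 < σ) :
    Integrable fun t => powerKernel α t * Real.exp (-(σ * t)) := by
  -- the integral of a non-integrable function would be zero
  refine not_imp_comm.1 integral_undef ?_
  rw [integral_powerKernel_mul_exp hα hσ]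
  exact (Real.rpow_pos_of_pos hσ _).ne'

theorem integral_powerKernel {α t : ℝ} (hα : 0 < α) (ht : 0 ≤ t) :
    ∫ u in Ioc 0 t, powerKernel α u = powerKernel (α + 1) t := by
  have h1 : ∫ u in Ioc 0 t, powerKernel α u =
      ∫ u in Ioc 0 t, (Real.Gamma α)⁻¹ * u ^ (α - 1) := by
    refine setIntegral_congr_fun measurableSet_Ioc fun u hu => ?_
    simp only [powerKernel, if_pos hu.1]
    ring
  rw [h1, integral_const_mul, ← intervalIntegral.integral_of_le ht,
    integral_rpow (Or.inl (by linarith)), sub_add_cancel, Real.zero_rpow hα.ne', sub_zero]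
  rcases ht.eq_or_lt with rfl | ht
  · simp [powerKernel, Real.zero_rpow hα.ne']
  · rw [powerKernel, if_pos ht, Real.Gamma_add_one hα.ne', add_sub_cancel_right]
    have := (Real.Gamma_pos_of_pos hα).ne'
    field_simp

section NeumannSeries

variable {ι : Type*}

/-- The sum of `δ` over the letters of a word. -/
def wordExponent (δ : ι → ℝ) (w : Σ n, Fin n → ι) : ℝ := ∑ i, δ (w.2 i)

/-- The product of `-b` over the letters of a word. -/
def wordCoeff (b : ι → ℂ) (w : Σ n, Fin n → ι) : ℂ := ∏ i, -b (w.2 i)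

/-- The inverse Laplace transform of `s ^ (-β) / (1 + ∑ b_i s ^ (-δ_i))`, from its expansion in
powers of `s`. The words over `ι` index the terms of `(-∑ b_i s ^ (-δ_i)) ^ n`, `n ≥ 0`. -/
noncomputable def neumannSeries (b : ι → ℂ) (δ : ι → ℝ) (β t : ℝ) : ℂ :=
  ∑' w : Σ n, Fin n → ι, wordCoeff b w * powerKernel (β + wordExponent δ w) t

theorem neumannSeries_of_nonpos (b : ι → ℂ) (δ : ι → ℝ) (β : ℝ) {t : ℝ} (ht : t ≤ 0) :
    neumannSeries b δ β t = 0 := by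
  simp [neumannSeries, powerKernel_of_nonpos _ ht]

variable {b : ι → ℂ} {δ : ι → ℝ} {β σ : ℝ}

theorem wordExponent_nonneg (hδ : ∀ i, 0 < δ i) (w : Σ n, Fin n → ι) : 0 ≤ wordExponent δ w :=
  Finset.sum_nonneg fun _ _ => (hδ _).le

theorem wordCoeff_mul_rpow (hσ : 0 < σ) (w : Σ n, Fin n → ι) :
    wordCoeff b w * ((σ ^ (-(β + wordExponent δ w)) : ℝ) : ℂ) =
      ((σ ^ (-β) : ℝ) : ℂ) * ∏ i, (-b (w.2 i) * ((σ ^ (-δ (w.2 i)) : ℝ) : ℂ)) := by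
  rw [neg_add, Real.rpow_add hσ, wordExponent, ← Finset.sum_neg_distrib,
    Real.rpow_sum_of_pos hσ, Finset.prod_mul_distrib, wordCoeff]
  push_cast
  ring

theorem norm_wordCoeff_mul_powerKernel_mul_exp (hδ : ∀ i, 0 < δ i) (hβ : 0 < β)
    (w : Σ n, Fin n → ι) (t : ℝ) :
    ‖wordCoeff b w * powerKernel (β + wordExponent δ w) t * (Real.exp (-(σ * t)) : ℂ)‖ =
      ‖wordCoeff b w‖ * (powerKernel (β + wordExponent δ w) t * Real.exp (-(σ * t))) := by
  have := wordExponent_nonneg hδ w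
  rw [norm_mul, norm_mul, Complex.norm_real, Complex.norm_real, mul_assoc,
    Real.norm_of_nonneg (powerKernel_nonneg (by linarith) t),
    Real.norm_of_nonneg (Real.exp_pos _).le]

variable [Fintype ι]

theorem summable_integral_norm_neumannSeries (hδ : ∀ i, 0 < δ i) (hβ : 0 < β) (hσ : 0 < σ)
    (hq : ∑ i, ‖b i‖ * σ ^ (-δ i) < 1) :
    (∀ w : Σ n, Fin n → ι, Integrable fun t : ℝ =>
      wordCoeff b w * powerKernel (β + wordExponent δ w) t * (Real.exp (-(σ * t)) : ℂ)) ∧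
    Summable fun w : Σ n, Fin n → ι => ∫ t : ℝ,
      ‖wordCoeff b w * powerKernel (β + wordExponent δ w) t * (Real.exp (-(σ * t)) : ℂ)‖ := by
  refine ⟨fun w => ?_, ?_⟩
  · have := wordExponent_nonneg hδ w
    refine (((integrable_powerKernel_mul_exp (α := β + wordExponent δ w) (by linarith)
      hσ).ofReal (𝕜 := ℂ)).const_mul (wordCoeff b w)).congr (ae_of_all _ fun t => ?_)
    simp only [RCLike.ofReal_mul, Complex.coe_algebraMap, mul_assoc]
  · have hx : ∑ i, ‖-b i * ((σ ^ (-δ i) : ℝ) : ℂ)‖ < 1 := by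
      refine lt_of_eq_of_lt (Finset.sum_congr rfl fun i _ => ?_) hq
      rw [norm_mul, norm_neg, Complex.norm_real, Real.norm_of_nonneg (Real.rpow_nonneg hσ.le _)]
    refine ((hasSum_words _ hx).1.mul_left (σ ^ (-β))).congr fun w => ?_
    have := wordExponent_nonneg hδ w
    simp only [norm_wordCoeff_mul_powerKernel_mul_exp hδ hβ]
    rw [integral_const_mul, integral_powerKernel_mul_exp (by linarith) hσ]
    have h1 := congrArg norm (wordCoeff_mul_rpow (b := b) (δ := δ) (β := β) hσ w)
    rw [norm_mul, norm_mul, Complex.norm_real, Complex.norm_real,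
      Real.norm_of_nonneg (Real.rpow_nonneg hσ.le _),
      Real.norm_of_nonneg (Real.rpow_nonneg hσ.le _)] at h1
    exact h1.symm

theorem integral_neumannSeries_mul_exp (hδ : ∀ i, 0 < δ i) (hβ : 0 < β) (hσ : 0 < σ)
    (hq : ∑ i, ‖b i‖ * σ ^ (-δ i) < 1) :
    Integrable (fun t => neumannSeries b δ β t * (Real.exp (-(σ * t)) : ℂ)) ∧
    ∫ t, neumannSeries b δ β t * (Real.exp (-(σ * t)) : ℂ) =
      ((σ ^ (-β) : ℝ) : ℂ) * (1 + ∑ i, b i * ((σ ^ (-δ i) : ℝ) : ℂ))⁻¹ := by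
  obtain ⟨hi, hs⟩ := summable_integral_norm_neumannSeries hδ hβ hσ hq
  have heq : (fun t => neumannSeries b δ β t * (Real.exp (-(σ * t)) : ℂ)) = fun t : ℝ =>
      ∑' w : Σ n, Fin n → ι,
        wordCoeff b w * powerKernel (β + wordExponent δ w) t * (Real.exp (-(σ * t)) : ℂ) := by
    funext t
    rw [neumannSeries, tsum_mul_right]
  rw [heq]
  refine ⟨integrable_tsum_of_summable_integral_norm hi hs, ?_⟩
  have h1 := hasSum_integral_of_summable_integral_norm hi hs
  have hx : ∑ i, ‖-b i * ((σ ^ (-δ i) : ℝ) : ℂ)‖ < 1 := by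
    refine lt_of_eq_of_lt (Finset.sum_congr rfl fun i _ => ?_) hq
    rw [norm_mul, norm_neg, Complex.norm_real, Real.norm_of_nonneg (Real.rpow_nonneg hσ.le _)]
  have h2 := (hasSum_words _ hx).2.mul_left ((σ ^ (-β) : ℝ) : ℂ)
  simp only [neg_mul, Finset.sum_neg_distrib, sub_neg_eq_add] at h2
  refine h1.unique (h2.congr_fun fun w => ?_)
  have := wordExponent_nonneg hδ w
  simp only [mul_assoc]
  rw [integral_const_mul]
  have h3 : ∫ t : ℝ, (powerKernel (β + wordExponent δ w) t : ℂ) * (Real.exp (-(σ * t)) : ℂ) =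
      ((σ ^ (-(β + wordExponent δ w)) : ℝ) : ℂ) := by
    rw [← integral_powerKernel_mul_exp (by linarith) hσ, ← integral_complex_ofReal]
    simp only [Complex.ofReal_mul]
  rw [h3, wordCoeff_mul_rpow hσ]
  simp

theorem locallyIntegrable_of_integrable_mul_exp {f : ℝ → ℂ} {σ : ℝ}
    (hf : Integrable fun t => f t * (Real.exp (-(σ * t)) : ℂ)) : LocallyIntegrable f := by
  have hc : Continuous fun t : ℝ => (Real.exp (σ * t) : ℂ) := by fun_prop
  have h := (hf.locallyIntegrable.locallyIntegrableOn univ).mul_continuousOn hc.continuousOn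
    isOpen_univ.isLocallyClosed
  rw [locallyIntegrableOn_univ] at h
  refine h.congr (ae_of_all _ fun t => ?_)
  change f t * (Real.exp (-(σ * t)) : ℂ) * (Real.exp (σ * t) : ℂ) = f t
  rw [mul_assoc, ← Complex.ofReal_mul, ← Real.exp_add]
  simp

theorem neumannSeries_eq_integral (hδ : ∀ i, 0 < δ i) (hβ : 0 < β) (hσ : 0 < σ)
    (hq : ∑ i, ‖b i‖ * σ ^ (-δ i) < 1) (t : ℝ) :
    neumannSeries b δ (β + 1) t = ∫ u in (0 : ℝ)..t, neumannSeries b δ β u := by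
  rcases le_total t 0 with ht | ht
  · rw [neumannSeries_of_nonpos b δ _ ht, intervalIntegral.integral_of_ge ht,
      setIntegral_congr_fun (g := fun _ => 0) measurableSet_Ioc fun u hu =>
        neumannSeries_of_nonpos b δ β hu.2]
    simp
  · obtain ⟨hi, hs⟩ := summable_integral_norm_neumannSeries hδ hβ hσ hq
    have hli : ∀ w : Σ n, Fin n → ι, IntegrableOn (fun u : ℝ =>
        wordCoeff b w * (powerKernel (β + wordExponent δ w) u : ℂ)) (Ioc 0 t) := fun w =>
      ((locallyIntegrable_of_integrable_mul_exp (hi w)).integrableOn_isCompact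
        isCompact_Icc).mono_set Ioc_subset_Icc_self
    -- on `(0, t]` the weight `e^{-σu}` is bounded below
    have hsum : Summable fun w : Σ n, Fin n → ι => ∫ u in Ioc 0 t,
        ‖wordCoeff b w * (powerKernel (β + wordExponent δ w) u : ℂ)‖ := by
      refine (hs.mul_left (Real.exp (σ * t))).of_nonneg_of_le
        (fun w => integral_nonneg fun u => norm_nonneg _) fun w => ?_
      rw [← integral_const_mul]
      refine (setIntegral_mono_on (hli w).norm ((hi w).norm.const_mul _).integrableOn
        measurableSet_Ioc fun u hu => ?_).trans (setIntegral_le_integral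
          ((hi w).norm.const_mul _) (ae_of_all _ fun u => by positivity))
      rw [norm_mul (_ * _), Complex.norm_real, Real.norm_of_nonneg (Real.exp_pos _).le,
        mul_left_comm, ← Real.exp_add]
      refine le_mul_of_one_le_right (norm_nonneg _) (Real.one_le_exp ?_)
      nlinarith [hu.2]
    have h := (hasSum_integral_of_summable_integral_norm hli hsum).tsum_eq
    rw [intervalIntegral.integral_of_le ht]
    refine Eq.trans ?_ h
    refine tsum_congr fun w => ?_
    have := wordExponent_nonneg hδ w
    rw [integral_const_mul, integral_complex_ofReal, integral_powerKernel (by linarith) ht,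
      add_right_comm]

end NeumannSeries

theorem isLocallyAbsCont_integral {u : ℝ → ℂ} (hu : LocallyIntegrable u) :
    IsLocallyAbsCont fun t => ∫ x in (0 : ℝ)..t, u x := by
  intro b c
  have hii : ∀ x y : ℝ, IntervalIntegrable u volume x y := fun x y =>
    (hu.integrableOn_isCompact isCompact_uIcc).intervalIntegrable
  have hn := ((hii b c).norm).absolutelyContinuousOnInterval_intervalIntegral left_mem_uIcc
  refine squeeze_zero (fun E => Finset.sum_nonneg fun _ _ => dist_nonneg)
    (fun E => Finset.sum_le_sum fun i _ => ?_) hn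
  rw [dist_comm, dist_eq_norm, intervalIntegral.integral_interval_sub_left (hii _ _) (hii _ _),
    dist_comm, Real.dist_eq,
    intervalIntegral.integral_interval_sub_left (hii _ _).norm (hii _ _).norm]
  exact intervalIntegral.norm_integral_le_abs_integral_norm

/-! ### The inverse of the symbol -/

/-- At a positive real point, the leading power of the symbol factored out. -/
theorem fracSymbol_ofReal {k : ℕ} (a : Fin (k + 1) → ℂ) (γ : Fin (k + 1) → ℝ) (ha : a 0 ≠ 0)
    {σ : ℝ} (hσ : 0 < σ) :
    fracSymbol a γ σ = a 0 * ((σ ^ γ 0 : ℝ) : ℂ) *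
      (1 + ∑ i : Fin k, a i.succ / a 0 * ((σ ^ (-(γ 0 - γ i.succ)) : ℝ) : ℂ)) := by
  rw [fracSymbol, Fin.sum_univ_succ, mul_add, mul_one, Finset.mul_sum]
  congr 1
  · rw [Complex.ofReal_cpow hσ.le]
  · refine Finset.sum_congr rfl fun i _ => ?_
    rw [← Complex.ofReal_cpow hσ.le, mul_mul_mul_comm, mul_div_cancel₀ _ ha, ← Complex.ofReal_mul,
      ← Real.rpow_add hσ]
    congr 3
    ring

theorem lemma1 (k : ℕ) (a : Fin (k + 1) → ℂ) (γ : Fin (k + 1) → ℝ)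
    (hγ : StrictAnti γ) (hγ02 : ∀ i, γ i ∈ Ico (0 : ℝ) 2)
    (ha : a 0 ≠ 0) (hγ0 : 0 < γ 0)
    (hA0 : ∀ s : ℂ, 0 < s.re → fracSymbol a γ s ≠ 0) :
    (∃! l : 𝓢'(ℝ, ℂ), IsInverseLaplace l (fun s => 1 / fracSymbol a γ s)) ∧
    ∀ l : 𝓢'(ℝ, ℂ), IsInverseLaplace l (fun s => 1 / fracSymbol a γ s) →
      ∃ f : ℝ → ℂ, IsRepresentedBy l f ∧ (∀ t < 0, f t = 0) ∧
        LocallyIntegrable f ∧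
        (1 < γ 0 - γ (Fin.last k) → IsLocallyAbsCont f) := by
  refine ⟨?_, fun l hl => ?_⟩
  · obtain ⟨C, m, hC⟩ := exists_le_norm_fracSymbol a γ hγ hγ02 ha hA0
    obtain ⟨l, hl⟩ := exists_isInverseLaplace (F := fun s => 1 / fracSymbol a γ s) (C := C) (m := m)
      (fun s hs => ((differentiableAt_const 1).div
        (analyticAt_fracSymbol a γ (Or.inl hs)).differentiableAt
        (hA0 s hs)).differentiableWithinAt)
      (fun s hs => by
        rw [norm_div, norm_one, mul_one_div, div_le_iff₀ (norm_pos_iff.2 (hA0 s hs))]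
        exact hC s hs)
    refine ⟨l, hl, fun l' hl' => ?_⟩
    rw [← sub_eq_zero]
    refine SupportedInNonneg.eq_zero_of_laplaceTransform (fun ψ hψ => ?_) fun s hs => ?_
    · change l' ψ - l ψ = 0
      rw [hl'.1 ψ hψ, hl.1 ψ hψ, sub_zero]
    · change laplaceTransform l' s hs - laplaceTransform l s hs = 0
      rw [hl'.2, hl.2, sub_self]
  · set b : Fin k → ℂ := fun i => a i.succ / a 0 with hb
    set δ : Fin k → ℝ := fun i => γ 0 - γ i.succ with hδ
    have hδ0 : ∀ i, 0 < δ i := fun i => sub_pos.2 (hγ (Fin.succ_pos i))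
    -- far to the right the leading power dominates, so that the Neumann series converges
    obtain ⟨M, hM1, hM⟩ : ∃ M : ℕ, 1 ≤ M ∧ ∀ σ : ℝ, M ≤ σ → ∑ i, ‖b i‖ * σ ^ (-δ i) < 1 := by
      have hlim : Tendsto (fun σ : ℝ => ∑ i, ‖b i‖ * σ ^ (-δ i)) atTop (𝓝 (∑ i : Fin k, 0)) :=
        tendsto_finsetSum _ fun i _ => by
          simpa using (tendsto_rpow_neg_atTop (hδ0 i)).const_mul ‖b i‖
      rw [Finset.sum_const_zero] at hlim
      obtain ⟨S, hS⟩ := eventually_atTop.1 (hlim.eventually_lt_const one_pos)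
      refine ⟨max 1 ⌈S⌉₊, le_max_left _ _, fun σ hσ => hS σ ?_⟩
      refine (Nat.le_ceil S).trans (le_trans ?_ hσ)
      exact_mod_cast le_max_right _ _
    have hM0 : (0 : ℝ) < M := by exact_mod_cast hM1
    have hexp : ∀ (n : ℕ) (t : ℝ), Complex.exp (-(n : ℂ) * t) =
        ((Real.exp (-((n : ℝ) * t)) : ℝ) : ℂ) := by
      intro n t
      push_cast
      rw [neg_mul]
    set f : ℝ → ℂ := fun t => (a 0)⁻¹ * neumannSeries b δ (γ 0) t with hf
    have hlap : ∀ j : ℕ, Integrable (fun t => f t * Complex.exp (-((M + j : ℕ) : ℂ) * t)) ∧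
        ∫ t, f t * Complex.exp (-((M + j : ℕ) : ℂ) * t) = 1 / fracSymbol a γ (M + j : ℕ) := by
      intro j
      have hσ : (M : ℝ) ≤ ((M + j : ℕ) : ℝ) := by exact_mod_cast Nat.le_add_right M j
      have hσ0 : (0 : ℝ) < ((M + j : ℕ) : ℝ) := hM0.trans_le hσ
      obtain ⟨h1, h2⟩ := integral_neumannSeries_mul_exp (b := b) (δ := δ) hδ0 hγ0 hσ0 (hM _ hσ)
      simp only [hexp, hf, mul_assoc (a 0)⁻¹]
      refine ⟨h1.const_mul _, ?_⟩
      rw [integral_const_mul, h2, ← Complex.ofReal_natCast, fracSymbol_ofReal a γ ha hσ0,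
        Real.rpow_neg hσ0.le, one_div, mul_inv, mul_inv, mul_assoc, Complex.ofReal_inv]
    have hf0 : ∀ t < 0, f t = 0 := fun t ht => by
      simp only [hf, neumannSeries_of_nonpos b δ _ ht.le, mul_zero]
    have hfi : Integrable fun t => f t * Complex.exp (-(M : ℂ) * t) := by simpa using (hlap 0).1
    refine ⟨f, hl.1.isRepresentedBy hM1 hf0 hfi fun j => ?_, hf0, ?_, fun hγk => ?_⟩
    · rw [(hlap j).2, hl.2]
    · simp only [hexp] at hfi
      exact locallyIntegrable_of_integrable_mul_exp hfi
    · have hβ : 0 < γ 0 - 1 := by linarith [(hγ02 (Fin.last k)).1]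
      have hli : LocallyIntegrable (neumannSeries b δ (γ 0 - 1)) :=
        locallyIntegrable_of_integrable_mul_exp
          (integral_neumannSeries_mul_exp hδ0 hβ hM0 (hM M le_rfl)).1
      have heq : f = fun t => ∫ x in (0 : ℝ)..t, (a 0)⁻¹ * neumannSeries b δ (γ 0 - 1) x := by
        funext t
        rw [intervalIntegral.integral_const_mul,
          ← neumannSeries_eq_integral hδ0 hβ hM0 (hM M le_rfl), sub_add_cancel]
      rw [heq]
      exact isLocallyAbsCont_integral (hli.smul (a 0)⁻¹)
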